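/- Let $R$ be an associative ring with identity, and let $\mathrm K(R)$ be the homotopy category of (unbounded) complexes of left $R$-modules, with its standard triangulated structure and suspension $\Sigma$. A complex $X$ is dg-projective if every $X^n$ is projective and every chain map from $X$ to an exact complex is null homotopic; it is dg-injective if every $X^n$ is injective and every chain map from an exact complex to $X$ is null homotopic. Let $dg\mathscr P$ and $dg\mathscr I$ be the full subcategories of $\mathrm K(R)$ of the objects isomorphic in $\mathrm K(R)$ to dg-projective, respectively dg-injective, complexes. For full subcategories $\mathcal X,\mathcal Y$ of a triangulated category $\mathcal C$, let $\xi_{\mathcal X}$ (resp. $\xi^{\mathcal Y}$) be the class of distinguished triangles $A\to B\to C\to\Sigma A$ such that $\mathcal C(X,A)\to\mathcal C(X,B)$ is injective and $\mathcal C(X,B)\to\mathcal C(X,C)$ is surjective for all $X\in\mathcal X$ (resp. $\mathcal C(C,Y)\to\mathcal C(B,Y)$ is injective and $\mathcal C(B,Y)\to\mathcal C(A,Y)$ is surjective for all $Y\in\mathcal Y$). For a class $\xi$ of triangles, an object $P$ is $\xi$-projective if $0\to\mathcal C(P,A)\to\mathcal C(P,B)\to\mathcal C(P,C)\to0$ is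 exact for every triangle $A\to B\to C\to\Sigma A$ in $\xi$, and there are enough $\xi$-projectives if every object $A$ has a triangle $K\to P\to A\to\Sigma K$ in $\xi$ with $P$ $\xi$-projective; $\xi$-injectives are defined dually. The pair $(\mathcal X,\mathcal Y)$ is a balanced pair if $\mathcal X$ and $\mathcal Y$ are $\Sigma$-stable full additive subcategories closed under direct summands, $\xi_{\mathcal X}=\xi^{\mathcal Y}$, $\mathcal X$ is the class of $\xi_{\mathcal X}$-projectives, $\mathcal Y$ is the class of $\xi^{\mathcal Y}$-injectives, and there are enough $\xi_{\mathcal X}$-projectives and enough $\xi^{\mathcal Y}$-injectives. Then: 1. $(dg\mathscr P, dg\mathscr I)$ is a balanced pair in $\mathrm K(R)$. 2. The class $\xi:=\xi_{dg\mathscr P}=\xi^{dg\mathscr I}$ is a proper class of triangles (in the sense of Beligiannis). Put $\mathbb E_\xi(C,A)=\{\delta\in \mathrm{Hom}_{\mathrm K(R)}(C,\Sigma A) : \delta \text{ is the last map of a triangle } A\to B\to C\xrightarrow{\delta}\Sigma A \text{ in } \xi\}$, and let $\mathfrak s_\xi(\delta)$ be the equivalence class of $A\to B\to C$ for such a triangle.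 Then $(\mathrm K(R),\mathbb E_\xi,\mathfrak s_\xi)$ is an extriangulated category (in the sense of Nakaoka and Palu). 3. If $R$ is not a semisimple ring, then this extriangulated category is neither exact (its conflations do not form a Quillen exact structure on $\mathrm K(R)$) nor triangulated (it does not arise from any triangulated structure on the category $\mathrm K(R)$). -/

import Mathlib

open CategoryTheory CategoryTheory.Limits CategoryTheory.Pretriangulated Opposite

universe w v u

noncomputable section

namespace ExtriCat

/-! ### Quillen exact structures -/

section Exact

variable {C : Type u} [Category.{v} C] [Preadditive C]

/-- `f` is an admissible monomorphism for the class `S` of short sequences. -/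
def Inflation (S : ObjectProperty (ShortComplex C)) {A B : C} (f : A ⟶ B) : Prop :=
  ∃ (D : C) (g : B ⟶ D) (w : f ≫ g = 0), S (ShortComplex.mk f g w)

/-- `g` is an admissible epimorphism for the class `S` of short sequences. -/
def Deflation (S : ObjectProperty (ShortComplex C)) {B D : C} (g : B ⟶ D) : Prop :=
  ∃ (A : C) (f : A ⟶ B) (w : f ≫ g = 0), S (ShortComplex.mk f g w)

/-- `S` is an exact structure in the sense of Quillen on the additive category `C`: an
isomorphism-closed class of kernel-cokernel pairs satisfying the usual (self-dual) axioms. -/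
structure IsQuillenExact (S : ObjectProperty (ShortComplex C)) : Prop where
  kernel : ∀ T : ShortComplex C, S T → Nonempty (IsLimit (KernelFork.ofι T.f T.zero))
  cokernel : ∀ T : ShortComplex C, S T → Nonempty (IsColimit (CokernelCofork.ofπ T.g T.zero))
  of_iso : ∀ T T' : ShortComplex C, Nonempty (T ≅ T') → S T → S T'
  inflation_id : ∀ A : C, Inflation S (𝟙 A)
  deflation_id : ∀ A : C, Deflation S (𝟙 A)
  inflation_comp : ∀ {A B D : C} (f : A ⟶ B) (g : B ⟶ D),
    Inflation S f → Inflation S g → Inflation S (f ≫ g)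
  deflation_comp : ∀ {A B D : C} (f : A ⟶ B) (g : B ⟶ D),
    Deflation S f → Deflation S g → Deflation S (f ≫ g)
  pushout : ∀ {A B A' : C} (f : A ⟶ B) (a : A ⟶ A'), Inflation S f →
    ∃ (B' : C) (b : B ⟶ B') (f' : A' ⟶ B'), IsPushout f a b f' ∧ Inflation S f'
  pullback : ∀ {B D D' : C} (g : B ⟶ D) (c : D' ⟶ D), Deflation S g →
    ∃ (B' : C) (b : B' ⟶ B) (g' : B' ⟶ D'), IsPullback b g' g c ∧ Deflation S g'

end Exact

/-! ### Extriangulated categories -/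

section Extriangulated

variable (C : Type u) [Category.{v} C] [Preadditive C]

/-- A bifunctor `𝔼 : Cᵒᵖ × C ⥤ Ab` together with the relation "`𝔰(δ)` is the class of the sequence
`A ⟶ B ⟶ X`", for `δ ∈ 𝔼(X, A)`. The laws are in `ExtData.IsExtriangulated`. -/
structure ExtData where
  /-- the bifunctor, with `𝔼(X, A) = (E.obj (op X)).obj A` -/
  E : Cᵒᵖ ⥤ C ⥤ AddCommGrpCat.{w}
  /-- `Realizes x y δ`: the sequence `A ⟶ B ⟶ X` given by `x`, `y` belongs to `𝔰(δ)` -/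
  Realizes : ∀ {A B X : C}, (A ⟶ B) → (B ⟶ X) → ((E.obj (op X)).obj A) → Prop

variable {C}

namespace ExtData

variable (𝒟 : ExtData.{w} C)

/-- The group `𝔼(X, A)` of extensions. -/
abbrev Ext (X A : C) : Type w := (𝒟.E.obj (op X)).obj A

variable {𝒟}

/-- `a_* δ = 𝔼(X, a)(δ)`. -/
def push {X A A' : C} (a : A ⟶ A') (δ : 𝒟.Ext X A) : 𝒟.Ext X A' :=
  ((𝒟.E.obj (op X)).map a).hom δ

/-- `c^* δ = 𝔼(c, A)(δ)`. -/
def pull {X X' A : C} (c : X' ⟶ X) (δ : 𝒟.Ext X A) : 𝒟.Ext X' A :=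
  ((𝒟.E.map c.op).app A).hom δ

/-- `δ ⊕ δ' ∈ 𝔼(X ⊕ X', A ⊕ A')`: the element whose four components are `δ`, `0`, `0`, `δ'`. -/
def directSum [HasBinaryBiproducts C] {X X' A A' : C} (δ : 𝒟.Ext X A) (δ' : 𝒟.Ext X' A') :
    𝒟.Ext (X ⊞ X') (A ⊞ A') :=
  push biprod.inl (pull biprod.fst δ) + push biprod.inr (pull biprod.snd δ')

variable (𝒟)

/-- `(C, 𝔼, 𝔰)` is an extriangulated category in the sense of Nakaoka and Palu. -/
structure IsExtriangulated [HasZeroObject C] [HasBinaryBiproducts C] : Prop where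
  -- `𝔼` is an additive bifunctor
  additive_left : 𝒟.E.Additive
  additive_right : ∀ X : Cᵒᵖ, (𝒟.E.obj X).Additive
  -- `𝔰` sends every extension to precisely one equivalence class of sequences
  exists_realization : ∀ {X A : C} (δ : 𝒟.Ext X A),
    ∃ (B : C) (x : A ⟶ B) (y : B ⟶ X), 𝒟.Realizes x y δ
  realizes_iff : ∀ {X A B B' : C} (δ : 𝒟.Ext X A) (x : A ⟶ B) (y : B ⟶ X) (x' : A ⟶ B')
    (y' : B' ⟶ X), 𝒟.Realizes x y δ →
      (𝒟.Realizes x' y' δ ↔ ∃ b : B ≅ B', x ≫ b.hom = x' ∧ b.hom ≫ y' = y)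
  -- `𝔰` is a realization of `𝔼`
  realization : ∀ {X A B X' A' B' : C} (δ : 𝒟.Ext X A) (δ' : 𝒟.Ext X' A')
    (x : A ⟶ B) (y : B ⟶ X) (x' : A' ⟶ B') (y' : B' ⟶ X') (a : A ⟶ A') (c : X ⟶ X'),
    𝒟.Realizes x y δ → 𝒟.Realizes x' y' δ' → push a δ = pull c δ' →
      ∃ b : B ⟶ B', x ≫ b = a ≫ x' ∧ y ≫ c = b ≫ y'
  -- the realization is additive
  realizes_zero : ∀ X A : C,
    𝒟.Realizes (biprod.inl : A ⟶ A ⊞ X) (biprod.snd : A ⊞ X ⟶ X) 0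
  realizes_directSum : ∀ {X A B X' A' B' : C} (δ : 𝒟.Ext X A) (δ' : 𝒟.Ext X' A')
    (x : A ⟶ B) (y : B ⟶ X) (x' : A' ⟶ B') (y' : B' ⟶ X'),
    𝒟.Realizes x y δ → 𝒟.Realizes x' y' δ' →
      𝒟.Realizes (biprod.map x x') (biprod.map y y') (directSum δ δ')
  -- (ET3)
  et3 : ∀ {X A B X' A' B' : C} (δ : 𝒟.Ext X A) (δ' : 𝒟.Ext X' A')
    (x : A ⟶ B) (y : B ⟶ X) (x' : A' ⟶ B') (y' : B' ⟶ X') (a : A ⟶ A') (b : B ⟶ B'),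
    𝒟.Realizes x y δ → 𝒟.Realizes x' y' δ' → x ≫ b = a ≫ x' →
      ∃ c : X ⟶ X', y ≫ c = b ≫ y' ∧ push a δ = pull c δ'
  -- (ET3)ᵒᵖ
  et3_op : ∀ {X A B X' A' B' : C} (δ : 𝒟.Ext X A) (δ' : 𝒟.Ext X' A')
    (x : A ⟶ B) (y : B ⟶ X) (x' : A' ⟶ B') (y' : B' ⟶ X') (b : B ⟶ B') (c : X ⟶ X'),
    𝒟.Realizes x y δ → 𝒟.Realizes x' y' δ' → y ≫ c = b ≫ y' →
      ∃ a : A ⟶ A', x ≫ b = a ≫ x' ∧ push a δ = pull c δ'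
  -- (ET4)
  et4 : ∀ {A B D F G : C} (δ : 𝒟.Ext D A) (δ' : 𝒟.Ext F B)
    (f : A ⟶ B) (f' : B ⟶ D) (g : B ⟶ G) (g' : G ⟶ F),
    𝒟.Realizes f f' δ → 𝒟.Realizes g g' δ' →
      ∃ (H : C) (h' : G ⟶ H) (d : D ⟶ H) (e : H ⟶ F) (δ'' : 𝒟.Ext H A),
        f' ≫ d = g ≫ h' ∧ h' ≫ e = g' ∧
        𝒟.Realizes (f ≫ g) h' δ'' ∧
        𝒟.Realizes d e (push f' δ') ∧
        pull d δ'' = δ ∧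
        push f δ'' = pull e δ'
  -- (ET4)ᵒᵖ
  et4_op : ∀ {A B D F G : C} (δ : 𝒟.Ext B D) (δ' : 𝒟.Ext G F)
    (f' : D ⟶ A) (f : A ⟶ B) (g' : F ⟶ B) (g : B ⟶ G),
    𝒟.Realizes f' f δ → 𝒟.Realizes g' g δ' →
      ∃ (H : C) (d : D ⟶ H) (e : H ⟶ F) (h' : H ⟶ A) (δ'' : 𝒟.Ext G H),
        d ≫ h' = f' ∧ h' ≫ f = e ≫ g' ∧
        𝒟.Realizes h' (f ≫ g) δ'' ∧
        𝒟.Realizes d e (pull g' δ) ∧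
        push e δ'' = δ' ∧
        push d δ = pull g δ''

/-- The class of conflations: sequences that realize some extension. -/
def conflations : ObjectProperty (ShortComplex C) :=
  fun T => ∃ δ : 𝒟.Ext T.X₃ T.X₁, 𝒟.Realizes T.f T.g δ

/-- An extriangulated category is exact if its conflations form an exact structure on `C`. (The
extension group is then the group of Yoneda extensions, since a conflation determines the extension
that it realizes as soon as deflations are epimorphisms.) -/
def IsExact : Prop := IsQuillenExact 𝒟.conflations

/-- An extriangulated category is triangulated if it comes from a triangulated structure on `C`,
i.e. from a suspension `Σ` and a class of distinguished triangles satisfying the axioms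
(TR1)-(TR4): naturally `𝔼(X, A) ≅ Hom(X, ΣA)`, and `A ⟶ B ⟶ X` realizes `δ` if and only if
`A ⟶ B ⟶ X ⟶ ΣA`, with last map corresponding to `δ`, is a distinguished triangle. -/
def IsTriangulated [HasZeroObject C] : Prop :=
  ∃ (_ : HasShift C ℤ) (_ : ∀ n : ℤ, (shiftFunctor C n).Additive) (_ : Pretriangulated C)
    (_ : CategoryTheory.IsTriangulated C)
    (θ : ∀ X A : C, 𝒟.Ext X A ≃+ (X ⟶ A⟦(1 : ℤ)⟧)),
    (∀ {X A A' : C} (a : A ⟶ A') (δ : 𝒟.Ext X A), θ X A' (push a δ) = θ X A δ ≫ a⟦(1 : ℤ)⟧') ∧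
    (∀ {X X' A : C} (c : X' ⟶ X) (δ : 𝒟.Ext X A), θ X' A (pull c δ) = c ≫ θ X A δ) ∧
    (∀ {A B X : C} (x : A ⟶ B) (y : B ⟶ X) (δ : 𝒟.Ext X A),
      𝒟.Realizes x y δ ↔ Triangle.mk x y (θ X A δ) ∈ distTriang C)

end ExtData

end Extriangulated

/-! ### Classes of triangles in a triangulated category -/

section Triangles

variable {C : Type u} [Category.{v} C] [Preadditive C] [HasZeroObject C] [HasShift C ℤ]
  [∀ n : ℤ, (shiftFunctor C n).Additive] [Pretriangulated C]

/-- The direct sum of two triangles. -/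
def biprodTriangle (T₁ T₂ : Triangle C) : Triangle C :=
  Triangle.mk (biprod.map T₁.mor₁ T₂.mor₁) (biprod.map T₁.mor₂ T₂.mor₂)
    (biprod.desc (T₁.mor₃ ≫ (biprod.inl : T₁.obj₁ ⟶ T₁.obj₁ ⊞ T₂.obj₁)⟦(1 : ℤ)⟧')
      (T₂.mor₃ ≫ (biprod.inr : T₂.obj₁ ⟶ T₁.obj₁ ⊞ T₂.obj₁)⟦(1 : ℤ)⟧'))

/-- Proper classes of triangles in the sense of Beligiannis. The base change of a triangle
`A ⟶ B ⟶ X ⟶ ΣA` along `ε : Y ⟶ X` is a distinguished triangle `A ⟶ G ⟶ Y ⟶ ΣA` whose last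
map is the composition of `ε` with `X ⟶ ΣA`, and dually for cobase change; these are unique up to
isomorphism. -/
structure IsProperClass (ξ : Set (Triangle C)) : Prop where
  distinguished : ξ ⊆ distTriang C
  of_iso : ∀ T T' : Triangle C, Nonempty (T ≅ T') → T ∈ ξ → T' ∈ ξ
  biprod : ∀ T₁ T₂ : Triangle C, T₁ ∈ ξ → T₂ ∈ ξ → biprodTriangle T₁ T₂ ∈ ξ
  split : ∀ T ∈ distTriang C, T.mor₃ = 0 → T ∈ ξ
  suspension : ∀ T ∈ ξ, ∀ n : ℤ, (Triangle.shiftFunctor C n).obj T ∈ ξ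
  saturated : ∀ {A B X M Y G : C} (f : A ⟶ B) (g : B ⟶ X) (h : X ⟶ A⟦(1 : ℤ)⟧)
    (l : M ⟶ Y) (ε : Y ⟶ X) (z : X ⟶ M⟦(1 : ℤ)⟧) (f' : A ⟶ G) (g' : G ⟶ Y),
    Triangle.mk f g h ∈ distTriang C → Triangle.mk l ε z ∈ ξ → Triangle.mk f' g' (ε ≫ h) ∈ ξ →
      Triangle.mk f g h ∈ ξ
  base_change : ∀ {A B X Y G : C} (f : A ⟶ B) (g : B ⟶ X) (h : X ⟶ A⟦(1 : ℤ)⟧)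
    (ε : Y ⟶ X) (f' : A ⟶ G) (g' : G ⟶ Y),
    Triangle.mk f g h ∈ ξ → Triangle.mk f' g' (ε ≫ h) ∈ distTriang C →
      Triangle.mk f' g' (ε ≫ h) ∈ ξ
  cobase_change : ∀ {A B X A' G : C} (f : A ⟶ B) (g : B ⟶ X) (h : X ⟶ A⟦(1 : ℤ)⟧)
    (a : A ⟶ A') (f' : A' ⟶ G) (g' : G ⟶ X),
    Triangle.mk f g h ∈ ξ → Triangle.mk f' g' (h ≫ a⟦(1 : ℤ)⟧') ∈ distTriang C →
      Triangle.mk f' g' (h ≫ a⟦(1 : ℤ)⟧') ∈ ξ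

/-- The `ξ`-projective objects `P`: for every triangle `A ⟶ B ⟶ X ⟶ ΣA` in `ξ`, the sequence
`0 ⟶ Hom(P, A) ⟶ Hom(P, B) ⟶ Hom(P, X) ⟶ 0` is exact. -/
def projectives (ξ : Set (Triangle C)) : ObjectProperty C := fun P =>
  ∀ T ∈ ξ, Function.Injective (fun k : P ⟶ T.obj₁ => k ≫ T.mor₁) ∧
    Function.Exact (fun k : P ⟶ T.obj₁ => k ≫ T.mor₁) (fun k : P ⟶ T.obj₂ => k ≫ T.mor₂) ∧
    Function.Surjective (fun k : P ⟶ T.obj₂ => k ≫ T.mor₂)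

/-- The `ξ`-injective objects `I`: for every triangle `A ⟶ B ⟶ X ⟶ ΣA` in `ξ`, the sequence
`0 ⟶ Hom(X, I) ⟶ Hom(B, I) ⟶ Hom(A, I) ⟶ 0` is exact. -/
def injectives (ξ : Set (Triangle C)) : ObjectProperty C := fun I =>
  ∀ T ∈ ξ, Function.Injective (fun k : T.obj₃ ⟶ I => T.mor₂ ≫ k) ∧
    Function.Exact (fun k : T.obj₃ ⟶ I => T.mor₂ ≫ k) (fun k : T.obj₂ ⟶ I => T.mor₁ ≫ k) ∧
    Function.Surjective (fun k : T.obj₂ ⟶ I => T.mor₁ ≫ k)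

/-- There are enough `ξ`-projectives. -/
def EnoughProjectives (ξ : Set (Triangle C)) : Prop :=
  ∀ A : C, ∃ (K P : C) (f : K ⟶ P) (g : P ⟶ A) (h : A ⟶ K⟦(1 : ℤ)⟧),
    projectives ξ P ∧ Triangle.mk f g h ∈ ξ

/-- There are enough `ξ`-injectives. -/
def EnoughInjectives (ξ : Set (Triangle C)) : Prop :=
  ∀ A : C, ∃ (I K : C) (f : A ⟶ I) (g : I ⟶ K) (h : K ⟶ A⟦(1 : ℤ)⟧),
    injectives ξ I ∧ Triangle.mk f g h ∈ ξ

/-- `ξ_𝒳`: the distinguished triangles `A ⟶ B ⟶ X ⟶ ΣA` that are `Hom(𝒳, -)`-exact, i.e.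
`Hom(P, A) ⟶ Hom(P, B)` is injective and `Hom(P, B) ⟶ Hom(P, X)` is surjective for all `P`
in `𝒳`. -/
def lowerClass (𝒳 : ObjectProperty C) : Set (Triangle C) :=
  {T | T ∈ distTriang C ∧ ∀ P : C, 𝒳 P →
    Function.Injective (fun k : P ⟶ T.obj₁ => k ≫ T.mor₁) ∧
    Function.Surjective (fun k : P ⟶ T.obj₂ => k ≫ T.mor₂)}

/-- `ξ^𝒴`: the distinguished triangles `A ⟶ B ⟶ X ⟶ ΣA` that are `Hom(-, 𝒴)`-exact, i.e.
`Hom(X, I) ⟶ Hom(B, I)` is injective and `Hom(B, I) ⟶ Hom(A, I)` is surjective for all `I`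
in `𝒴`. -/
def upperClass (𝒴 : ObjectProperty C) : Set (Triangle C) :=
  {T | T ∈ distTriang C ∧ ∀ I : C, 𝒴 I →
    Function.Injective (fun k : T.obj₃ ⟶ I => T.mor₂ ≫ k) ∧
    Function.Surjective (fun k : T.obj₂ ⟶ I => T.mor₁ ≫ k)}

/-- `Σ`-stable (replete) full additive subcategories that are closed under direct summands. -/
structure IsStableAdditive (𝒳 : ObjectProperty C) : Prop where
  of_iso : ∀ X Y : C, Nonempty (X ≅ Y) → 𝒳 X → 𝒳 Y
  zero : ∀ X : C, IsZero X → 𝒳 X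
  biprod : ∀ X Y : C, 𝒳 X → 𝒳 Y → 𝒳 (X ⊞ Y)
  summand : ∀ X Y : C, 𝒳 (X ⊞ Y) → 𝒳 X
  suspension : ∀ X : C, 𝒳 X ↔ 𝒳 (X⟦(1 : ℤ)⟧)

/-- Balanced pairs in a triangulated category. -/
structure IsBalancedPair (𝒳 𝒴 : ObjectProperty C) : Prop where
  left : IsStableAdditive 𝒳
  right : IsStableAdditive 𝒴
  class_eq : lowerClass 𝒳 = upperClass 𝒴
  projectives_eq : 𝒳 = projectives (lowerClass 𝒳)
  injectives_eq : 𝒴 = injectives (upperClass 𝒴)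
  enoughProjectives : EnoughProjectives (lowerClass 𝒳)
  enoughInjectives : EnoughInjectives (upperClass 𝒴)

/-! ### The extriangulated structure attached to a proper class -/

variable {ξ : Set (Triangle C)}

lemma IsProperClass.pull_mem (hξ : IsProperClass ξ) {X Y A : C} (c : Y ⟶ X)
    (δ : X ⟶ A⟦(1 : ℤ)⟧)
    (hδ : ∃ (B : C) (x : A ⟶ B) (y : B ⟶ X), Triangle.mk x y δ ∈ ξ) :
    ∃ (B : C) (x : A ⟶ B) (y : B ⟶ Y), Triangle.mk x y (c ≫ δ) ∈ ξ := by
  obtain ⟨B, x, y, h⟩ := hδ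
  obtain ⟨G, f, g, h'⟩ := distinguished_cocone_triangle₂ (c ≫ δ)
  exact ⟨G, f, g, hξ.base_change x y δ c f g h h'⟩

lemma IsProperClass.push_mem (hξ : IsProperClass ξ) {X A A' : C} (a : A ⟶ A')
    (δ : X ⟶ A⟦(1 : ℤ)⟧)
    (hδ : ∃ (B : C) (x : A ⟶ B) (y : B ⟶ X), Triangle.mk x y δ ∈ ξ) :
    ∃ (B : C) (x : A' ⟶ B) (y : B ⟶ X), Triangle.mk x y (δ ≫ a⟦(1 : ℤ)⟧') ∈ ξ := by
  obtain ⟨B, x, y, h⟩ := hδ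
  obtain ⟨G, f, g, h'⟩ := distinguished_cocone_triangle₂ (δ ≫ a⟦(1 : ℤ)⟧')
  exact ⟨G, f, g, hξ.cobase_change x y δ a f g h h'⟩

/-- `𝔼_ξ(X, A) ⊆ Hom(X, ΣA)`: the morphisms `δ` for which there is a triangle
`A ⟶ B ⟶ X ⟶ ΣA` in `ξ` with last map `δ`. -/
def IsProperClass.extGroup (hξ : IsProperClass ξ) (X A : C) : AddSubgroup (X ⟶ A⟦(1 : ℤ)⟧) where
  carrier := {δ | ∃ (B : C) (x : A ⟶ B) (y : B ⟶ X), Triangle.mk x y δ ∈ ξ}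
  zero_mem' := by
    obtain ⟨G, f, g, h⟩ := distinguished_cocone_triangle₂ (0 : X ⟶ A⟦(1 : ℤ)⟧)
    exact ⟨G, f, g, hξ.split _ h rfl⟩
  add_mem' := by
    rintro δ₁ δ₂ ⟨B₁, x₁, y₁, h₁⟩ ⟨B₂, x₂, y₂, h₂⟩
    have h := hξ.push_mem (biprod.desc (𝟙 A) (𝟙 A)) _
      (hξ.pull_mem (biprod.lift (𝟙 X) (𝟙 X)) _ ⟨_, _, _, hξ.biprod _ _ h₁ h₂⟩)
    have e : (biprod.lift (𝟙 X) (𝟙 X) ≫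
        biprod.desc (δ₁ ≫ (biprod.inl : A ⟶ A ⊞ A)⟦(1 : ℤ)⟧')
          (δ₂ ≫ (biprod.inr : A ⟶ A ⊞ A)⟦(1 : ℤ)⟧')) ≫
        (biprod.desc (𝟙 A) (𝟙 A))⟦(1 : ℤ)⟧' = δ₁ + δ₂ := by
      simp [biprod.lift_desc, Preadditive.add_comp, ← Functor.map_comp]
    exact e ▸ h
  neg_mem' := by
    rintro δ h
    have h' := hξ.pull_mem (-𝟙 X) δ h
    rwa [Preadditive.neg_comp, Category.id_comp] at h'

/-- The bifunctor `𝔼_ξ`, a subfunctor of `Hom(-, Σ-)`. -/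
def IsProperClass.extFunctor (hξ : IsProperClass ξ) : Cᵒᵖ ⥤ C ⥤ AddCommGrpCat.{v} where
  obj X :=
    { obj := fun A => AddCommGrpCat.of (hξ.extGroup X.unop A)
      map := fun {A A'} a => AddCommGrpCat.ofHom
        { toFun := fun δ => ⟨δ.1 ≫ a⟦(1 : ℤ)⟧', hξ.push_mem a δ.1 δ.2⟩
          map_zero' := by ext; simp
          map_add' := fun _ _ => by ext; simp }
      map_id := fun A => by ext; simp
      map_comp := fun a b => by ext; simp }
  map {X Y} c :=
    { app := fun A => AddCommGrpCat.ofHom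
        { toFun := fun δ => ⟨c.unop ≫ δ.1, hξ.pull_mem c.unop δ.1 δ.2⟩
          map_zero' := by ext; simp
          map_add' := fun _ _ => by ext; simp }
      naturality := fun A A' a => by ext; simp }
  map_id X := by ext; simp
  map_comp c d := by ext; simp

/-- `(C, 𝔼_ξ, 𝔰_ξ)`, where `𝔰_ξ(δ)` is the class of `A ⟶ B ⟶ X` for any distinguished triangle
`A ⟶ B ⟶ X ⟶ ΣA` with last map `δ`. -/
def IsProperClass.extData (hξ : IsProperClass ξ) : ExtData.{v} C where
  E := hξ.extFunctor
  Realizes {A _ X} x y δ :=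
    Triangle.mk x y (show hξ.extGroup X A from δ).1 ∈ distTriang C

end Triangles

/-! ### dg-projective and dg-injective complexes -/

section Complexes

variable {R : Type u} [Ring R]

/-- The exact complexes all of whose cycles belong to the given class of modules. -/
def tildeClass (𝒳 : ObjectProperty (ModuleCat.{u} R)) :
    ObjectProperty (CochainComplex (ModuleCat.{u} R) ℤ) := fun K =>
  K.Acyclic ∧ ∀ n : ℤ, 𝒳 (K.cycles n)

/-- The class `dg𝒳` for a cotorsion pair `(𝒳, 𝒴)`. -/
def dgLeft (𝒳 𝒴 : ObjectProperty (ModuleCat.{u} R)) :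
    ObjectProperty (CochainComplex (ModuleCat.{u} R) ℤ) := fun K =>
  (∀ n : ℤ, 𝒳 (K.X n)) ∧
    ∀ (L : CochainComplex (ModuleCat.{u} R) ℤ) (f : K ⟶ L), tildeClass 𝒴 L →
      Nonempty (Homotopy f 0)

/-- The class `dg𝒴` for a cotorsion pair `(𝒳, 𝒴)`. -/
def dgRight (𝒳 𝒴 : ObjectProperty (ModuleCat.{u} R)) :
    ObjectProperty (CochainComplex (ModuleCat.{u} R) ℤ) := fun K =>
  (∀ n : ℤ, 𝒴 (K.X n)) ∧
    ∀ (L : CochainComplex (ModuleCat.{u} R) ℤ) (f : L ⟶ K), tildeClass 𝒳 L →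
      Nonempty (Homotopy f 0)

variable (R)

/-- The homotopy category `K(R)` of complexes of left `R`-modules. -/
abbrev KCat : Type (u + 1) := HomotopyCategory (ModuleCat.{u} R) (ComplexShape.up ℤ)

/-- The full subcategory of `K(R)` of the objects isomorphic to dg-projective complexes, i.e. to
complexes in `dg𝒫` for the cotorsion pair (projective modules, all modules). -/
def dgProjective : ObjectProperty (KCat R) := fun X =>
  ∃ K : CochainComplex (ModuleCat.{u} R) ℤ, dgLeft (isProjective (ModuleCat.{u} R)) ⊤ K ∧
    Nonempty (X ≅ (HomotopyCategory.quotient (ModuleCat.{u} R) (ComplexShape.up ℤ)).obj K)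

/-- The full subcategory of `K(R)` of the objects isomorphic to dg-injective complexes, i.e. to
complexes in `dgℐ` for the cotorsion pair (all modules, injective modules). -/
def dgInjective : ObjectProperty (KCat R) := fun X =>
  ∃ K : CochainComplex (ModuleCat.{u} R) ℤ, dgRight ⊤ (isInjective (C := ModuleCat.{u} R)) K ∧
    Nonempty (X ≅ (HomotopyCategory.quotient (ModuleCat.{u} R) (ComplexShape.up ℤ)).obj K)

end Complexes

end ExtriCat

end

/-! Let `𝒩` be the subcategory of acyclic complexes in `K(R)`. The dg-projectives are its left
orthogonal and the dg-injectives its right orthogonal (`leftOrthogonal_eq_dgProj`,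
`rightOrthogonal_eq_dgInj`). Every complex `A` lies in triangles `P ⟶ A ⟶ N` and `N' ⟶ A ⟶ I` with
`N`, `N'` acyclic, `P` dg-projective and `I` dg-injective. A morphism killed by all maps from
dg-projectives therefore factors through an acyclic complex, hence is killed by all maps to
dg-injectives, and conversely. A triangle lies in `ξ` exactly when its last map is such a phantom,
so the two classes agree, and the resolution triangles supply enough projectives and injectives
(`isBalancedPair_of_orthogonal`).

The resolutions come from a tower (`exists_trW_of_phantom`). Any `M` maps to a complex of injectives
with zero differential, injectively on homology. The fibre `F ⟶ M` is then killed by maps from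
complexes of projectives with zero differential. The homotopy limit of the iterated fibres receives
no nonzero map from such complexes, so it is acyclic; its map to `A` has a dg-injective cone, since
dg-injectives are closed under cones and countable products. The projective case is the same
argument in the opposite category.

Phantoms form a two-sided ideal, stable under shift. This gives the proper class
(`isProperClass_lowerClass`) and, with the octahedral axiom, the extriangulated structure
(`isExtriangulated_lowerClass`).

If the structure is exact, deflations are epimorphisms, so phantoms vanish. Identities of acyclic
complexes are phantom, hence every acyclic complex is contractible and every module is projective.
If the structure is triangulated, each `A ⟶ 0` is an inflation, which makes isomorphisms phantom and
all dg-projectives zero, hence `R = 0`. In both cases `R` is semisimple. -/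

noncomputable section

namespace ExtriCat

/-! ### Phantom morphisms as an ideal. -/

section Phantom

variable {C : Type u} [Category.{v} C] [Preadditive C]

/-- A morphism is `𝒳`-phantom if it vanishes after precomposition with morphisms from `𝒳`. -/
def Phantom (𝒳 : ObjectProperty C) {X Y : C} (h : X ⟶ Y) : Prop :=
  ∀ (P : C), 𝒳 P → ∀ k : P ⟶ X, k ≫ h = 0

variable {𝒳 : ObjectProperty C}

lemma Phantom.precomp {X Y Z : C} {h : Y ⟶ Z} (hh : Phantom 𝒳 h) (c : X ⟶ Y) :
    Phantom 𝒳 (c ≫ h) := fun P hP k => by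
  rw [← Category.assoc]
  exact hh P hP _

lemma Phantom.postcomp {X Y Z : C} {h : X ⟶ Y} (hh : Phantom 𝒳 h) (a : Y ⟶ Z) :
    Phantom 𝒳 (h ≫ a) := fun P hP k => by
  rw [← Category.assoc, hh P hP k, zero_comp]

lemma Phantom.add {X Y : C} {h h' : X ⟶ Y} (hh : Phantom 𝒳 h) (hh' : Phantom 𝒳 h') :
    Phantom 𝒳 (h + h') := fun P hP k => by
  rw [Preadditive.comp_add, hh P hP, hh' P hP, add_zero]

lemma Phantom.units_smul {X Y : C} {h : X ⟶ Y} (hh : Phantom 𝒳 h) (n : ℤˣ) :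
    Phantom 𝒳 (n • h) := fun P hP k => by
  rw [Linear.comp_units_smul, hh P hP, smul_zero]

lemma phantom_zero (X Y : C) : Phantom 𝒳 (0 : X ⟶ Y) := fun _ _ _ => comp_zero

end Phantom

/-! ### Proper classes and balanced pairs in a triangulated category. -/

section ProperClass

variable {C : Type u} [Category.{v} C] [Preadditive C] [HasZeroObject C] [HasShift C ℤ]
  [∀ n : ℤ, (shiftFunctor C n).Additive] [Pretriangulated C]

/-- The direct sum of two triangles is their product in the category of triangles. -/
def biprodTriangleLift (T₁ T₂ : Triangle C) {T : Triangle C} (p : T ⟶ T₁) (q : T ⟶ T₂) :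
    T ⟶ biprodTriangle T₁ T₂ where
  hom₁ := biprod.lift p.hom₁ q.hom₁
  hom₂ := biprod.lift p.hom₂ q.hom₂
  hom₃ := biprod.lift p.hom₃ q.hom₃
  comm₁ := by
    change T.mor₁ ≫ biprod.lift p.hom₂ q.hom₂ =
      biprod.lift p.hom₁ q.hom₁ ≫ biprod.map T₁.mor₁ T₂.mor₁
    ext <;> simp
  comm₂ := by
    change T.mor₂ ≫ biprod.lift p.hom₃ q.hom₃ =
      biprod.lift p.hom₂ q.hom₂ ≫ biprod.map T₁.mor₂ T₂.mor₂
    ext <;> simp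
  comm₃ := by
    change T.mor₃ ≫ (biprod.lift p.hom₁ q.hom₁)⟦(1 : ℤ)⟧' = biprod.lift p.hom₃ q.hom₃ ≫
      biprod.desc (T₁.mor₃ ≫ (biprod.inl : T₁.obj₁ ⟶ T₁.obj₁ ⊞ T₂.obj₁)⟦(1 : ℤ)⟧')
      (T₂.mor₃ ≫ (biprod.inr : T₂.obj₁ ⟶ T₁.obj₁ ⊞ T₂.obj₁)⟦(1 : ℤ)⟧')
    rw [biprod.lift_desc, biprod.lift_eq, Functor.map_add, Functor.map_comp, Functor.map_comp,
      Preadditive.comp_add, p.comm₃_assoc, q.comm₃_assoc]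

/-- The first projection from a direct sum of triangles. -/
def biprodTriangleFst (T₁ T₂ : Triangle C) : biprodTriangle T₁ T₂ ⟶ T₁ where
  hom₁ := (biprod.fst : T₁.obj₁ ⊞ T₂.obj₁ ⟶ _)
  hom₂ := (biprod.fst : T₁.obj₂ ⊞ T₂.obj₂ ⟶ _)
  hom₃ := (biprod.fst : T₁.obj₃ ⊞ T₂.obj₃ ⟶ _)
  comm₁ := biprod.map_fst _ _
  comm₂ := biprod.map_fst _ _
  comm₃ := by
    change biprod.desc (T₁.mor₃ ≫ (biprod.inl : T₁.obj₁ ⟶ T₁.obj₁ ⊞ T₂.obj₁)⟦(1 : ℤ)⟧')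
      (T₂.mor₃ ≫ (biprod.inr : T₂.obj₁ ⟶ T₁.obj₁ ⊞ T₂.obj₁)⟦(1 : ℤ)⟧') ≫
        (biprod.fst : T₁.obj₁ ⊞ T₂.obj₁ ⟶ _)⟦(1 : ℤ)⟧' = biprod.fst ≫ T₁.mor₃
    ext <;> simp [← Functor.map_comp]

/-- The second projection from a direct sum of triangles. -/
def biprodTriangleSnd (T₁ T₂ : Triangle C) : biprodTriangle T₁ T₂ ⟶ T₂ where
  hom₁ := (biprod.snd : T₁.obj₁ ⊞ T₂.obj₁ ⟶ _)
  hom₂ := (biprod.snd : T₁.obj₂ ⊞ T₂.obj₂ ⟶ _)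
  hom₃ := (biprod.snd : T₁.obj₃ ⊞ T₂.obj₃ ⟶ _)
  comm₁ := biprod.map_snd _ _
  comm₂ := biprod.map_snd _ _
  comm₃ := by
    change biprod.desc (T₁.mor₃ ≫ (biprod.inl : T₁.obj₁ ⟶ T₁.obj₁ ⊞ T₂.obj₁)⟦(1 : ℤ)⟧')
      (T₂.mor₃ ≫ (biprod.inr : T₂.obj₁ ⟶ T₁.obj₁ ⊞ T₂.obj₁)⟦(1 : ℤ)⟧') ≫
        (biprod.snd : T₁.obj₁ ⊞ T₂.obj₁ ⟶ _)⟦(1 : ℤ)⟧' = biprod.snd ≫ T₂.mor₃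
    ext <;> simp [← Functor.map_comp]

/-- Products of distinguished triangles are distinguished, and the biproduct triangle satisfies the
universal property of a product indexed by `Bool`. -/
lemma biprodTriangle_distinguished (T₁ T₂ : Triangle C) (h₁ : T₁ ∈ distTriang C)
    (h₂ : T₂ ∈ distTriang C) : biprodTriangle T₁ T₂ ∈ distTriang C := by
  let T : Bool → Triangle C := fun b => cond b T₁ T₂
  have hT : ∀ b, T b ∈ distTriang C := by rintro (_ | _) <;> assumption
  let π : ∀ b, biprodTriangle T₁ T₂ ⟶ T b
    | true => biprodTriangleFst T₁ T₂
    | false => biprodTriangleSnd T₁ T₂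
  have hlim : IsLimit (Fan.mk (biprodTriangle T₁ T₂) π : Fan T) :=
    Fan.IsLimit.mk _ (fun s => biprodTriangleLift T₁ T₂ (s.proj true) (s.proj false))
      (fun s b => match b with
        | true => TriangleMorphism.ext (biprod.lift_fst _ _) (biprod.lift_fst _ _)
            (biprod.lift_fst _ _)
        | false => TriangleMorphism.ext (biprod.lift_snd _ _) (biprod.lift_snd _ _)
            (biprod.lift_snd _ _))
      (fun s m hm => TriangleMorphism.ext
        (biprod.hom_ext _ _
          ((congr_arg TriangleMorphism.hom₁ (hm true)).trans (biprod.lift_fst _ _).symm)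
          ((congr_arg TriangleMorphism.hom₁ (hm false)).trans (biprod.lift_snd _ _).symm))
        (biprod.hom_ext _ _
          ((congr_arg TriangleMorphism.hom₂ (hm true)).trans (biprod.lift_fst _ _).symm)
          ((congr_arg TriangleMorphism.hom₂ (hm false)).trans (biprod.lift_snd _ _).symm))
        (biprod.hom_ext _ _
          ((congr_arg TriangleMorphism.hom₃ (hm true)).trans (biprod.lift_fst _ _).symm)
          ((congr_arg TriangleMorphism.hom₃ (hm false)).trans (biprod.lift_snd _ _).symm)))
  exact isomorphic_distinguished _ (productTriangle_distinguished T hT) _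
    (hlim.conePointUniqueUpToIso (productTriangle.isLimitFan T))

variable {𝒳 𝒴 𝒩 : ObjectProperty C}

lemma IsStableAdditive.shift (h : IsStableAdditive 𝒳) (X : C) (hX : 𝒳 X) (n : ℤ) :
    𝒳 (X⟦n⟧) := by
  induction n using Int.induction_on with
  | zero => exact h.of_iso _ _ ⟨((shiftFunctorZero C ℤ).app X).symm⟩ hX
  | succ n ih =>
    exact h.of_iso _ _ ⟨((shiftFunctorAdd C (n : ℤ) 1).app X).symm⟩ ((h.suspension _).1 ih)
  | pred n ih =>
    refine (h.suspension _).2 (h.of_iso _ _ ⟨?_⟩ ih)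
    exact (shiftFunctorAdd' C (-(n : ℤ) - 1) 1 (-(n : ℤ)) (by lia)).app X

lemma Phantom.shift (h𝒳 : IsStableAdditive 𝒳) {X Y : C} {h : X ⟶ Y} (hh : Phantom 𝒳 h) (n : ℤ) :
    Phantom 𝒳 (h⟦n⟧') := fun P hP k => by
  obtain ⟨g, rfl⟩ := ((shiftEquiv C n).symm.toAdjunction.homEquiv _ _).surjective k
  have e : g ≫ h = 0 := hh _ (h𝒳.shift P hP (-n)) g
  have e' := ((shiftEquiv C n).symm.toAdjunction.homEquiv_naturality_right g h).symm
  refine e'.trans ((congr_arg _ e).trans ?_)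
  rw [Adjunction.homEquiv_unit]
  exact ((congr_arg _ (Functor.map_zero _ _ _)).trans comp_zero)

/-- In the long exact `Hom(P, -)` sequence, surjectivity onto `Hom(P, T.obj₃)` says that the
connecting map vanishes. Injectivity is the same statement for `ΣP`, so it comes for free from
`Σ`-stability. -/
lemma mem_lowerClass_iff (h𝒳 : IsStableAdditive 𝒳) (T : Triangle C) :
    T ∈ lowerClass 𝒳 ↔ T ∈ distTriang C ∧ Phantom 𝒳 T.mor₃ := by
  constructor
  · rintro ⟨hT, h⟩
    refine ⟨hT, fun P hP k => ?_⟩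
    obtain ⟨l, rfl⟩ := (h P hP).2 k
    simp [comp_distTriang_mor_zero₂₃ _ hT]
  · rintro ⟨hT, h⟩
    refine ⟨hT, fun P hP => ⟨fun a b hab => ?_, fun k => ?_⟩⟩
    · have hab' : (a - b)⟦(1 : ℤ)⟧' ≫ T.mor₁⟦(1 : ℤ)⟧' = 0 := by
        rw [← Functor.map_comp, Preadditive.sub_comp, sub_eq_zero.2 hab, Functor.map_zero]
      obtain ⟨g, hg⟩ := T.coyoneda_exact₁ hT _ hab'
      rw [h _ ((h𝒳.suspension P).1 hP) g, ← Functor.map_zero (shiftFunctor C (1 : ℤ))] at hg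
      exact sub_eq_zero.1 ((shiftFunctor C (1 : ℤ)).map_injective hg)
    · obtain ⟨g, hg⟩ := T.coyoneda_exact₃ hT k (h P hP k)
      exact ⟨g, hg.symm⟩

lemma mem_upperClass_iff (h𝒴 : IsStableAdditive 𝒴) (T : Triangle C) :
    T ∈ upperClass 𝒴 ↔ T ∈ distTriang C ∧
      ∀ I : C, 𝒴 I → ∀ k : T.obj₁⟦(1 : ℤ)⟧ ⟶ I, T.mor₃ ≫ k = 0 := by
  constructor
  · rintro ⟨hT, h⟩
    refine ⟨hT, fun I hI k => (h I hI).1 ?_⟩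
    simp [reassoc_of% comp_distTriang_mor_zero₂₃ _ hT]
  · rintro ⟨hT, h⟩
    refine ⟨hT, fun I hI => ⟨fun a b hab => ?_, fun k => ?_⟩⟩
    · have hab' : T.mor₂ ≫ (a - b) = 0 := by
        rw [Preadditive.comp_sub, sub_eq_zero.2 hab]
      obtain ⟨g, hg⟩ := T.yoneda_exact₃ hT _ hab'
      rw [h I hI g] at hg
      exact sub_eq_zero.1 hg
    · have hk := h _ ((h𝒴.suspension I).1 hI) (k⟦(1 : ℤ)⟧')
      -- The extension of `k` is found by mapping `T` to the split triangle on `I ⊞ I`, whose last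
      -- map is zero, and projecting back to `I`.
      obtain ⟨b, hb, -⟩ : ∃ b : T.obj₂ ⟶ I ⊞ I, T.mor₁ ≫ b = k ≫ biprod.inl ∧ _ :=
        complete_distinguished_triangle_morphism₂ T _ hT
        (binaryBiproductTriangle_distinguished I I) k 0 (hk.trans zero_comp.symm)
      refine ⟨b ≫ biprod.fst, ?_⟩
      change T.mor₁ ≫ b ≫ biprod.fst = k
      rw [reassoc_of% hb, biprod.inl_fst, Category.comp_id]

theorem isProperClass_lowerClass (h𝒳 : IsStableAdditive 𝒳) : IsProperClass (lowerClass 𝒳) where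
  distinguished _ hT := hT.1
  of_iso T T' := by
    rintro ⟨e⟩ hT
    rw [mem_lowerClass_iff h𝒳] at hT ⊢
    refine ⟨isomorphic_distinguished _ hT.1 _ e.symm, ?_⟩
    have : T'.mor₃ = e.inv.hom₃ ≫ T.mor₃ ≫ e.hom.hom₁⟦1⟧' := by
      rw [e.hom.comm₃, ← Category.assoc, Iso.inv_hom_id_triangle_hom₃, Category.id_comp]
    rw [this]
    exact (hT.2.postcomp _).precomp _
  biprod T₁ T₂ h₁ h₂ := by
    rw [mem_lowerClass_iff h𝒳] at h₁ h₂ ⊢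
    refine ⟨biprodTriangle_distinguished _ _ h₁.1 h₂.1, fun P hP k => ?_⟩
    have e : (biprodTriangle T₁ T₂).mor₃ = _ := biprod.desc_eq
    rw [e]
    exact ((h₁.2.postcomp _).precomp _).add ((h₂.2.postcomp _).precomp _) P hP k
  split T hT h := by
    rw [mem_lowerClass_iff h𝒳, h]
    exact ⟨hT, phantom_zero _ _⟩
  suspension T hT n := by
    rw [mem_lowerClass_iff h𝒳] at hT ⊢
    refine ⟨Triangle.shift_distinguished _ hT.1 n, fun P hP k => ?_⟩
    exact ((hT.2.shift h𝒳 n).postcomp _).units_smul n.negOnePow P hP k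
  saturated f g h l ε z f' g' hT h₁ h₂ := by
    rw [mem_lowerClass_iff h𝒳] at h₂ ⊢
    refine ⟨hT, fun P hP k => ?_⟩
    -- A test map to `X` lifts along `ε`, and `ε ≫ h` is already phantom.
    obtain ⟨k', hk'⟩ := (h₁.2 P hP).2 k
    change k' ≫ ε = k at hk'
    rw [← hk']
    exact (Category.assoc _ _ _).trans (h₂.2 P hP k')
  base_change f g h ε f' g' hT h' := by
    rw [mem_lowerClass_iff h𝒳] at hT ⊢
    exact ⟨h', hT.2.precomp ε⟩
  cobase_change f g h a f' g' hT h' := by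
    rw [mem_lowerClass_iff h𝒳] at hT ⊢
    exact ⟨h', hT.2.postcomp _⟩

lemma mem_extGroup_lowerClass_iff (h𝒳 : IsStableAdditive 𝒳)
    (hξ : IsProperClass (lowerClass 𝒳)) {X A : C} (δ : X ⟶ A⟦(1 : ℤ)⟧) :
    δ ∈ hξ.extGroup X A ↔ Phantom 𝒳 δ := by
  constructor
  · rintro ⟨B, x, y, h⟩
    exact ((mem_lowerClass_iff h𝒳 _).1 h).2
  · intro h
    obtain ⟨B, x, y, hT⟩ := distinguished_cocone_triangle₂ δ
    exact ⟨B, x, y, (mem_lowerClass_iff h𝒳 _).2 ⟨hT, h⟩⟩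

lemma isStableAdditive_leftOrthogonal (𝒩 : ObjectProperty C) [𝒩.IsTriangulated] :
    IsStableAdditive 𝒩.leftOrthogonal where
  of_iso _ _ := fun ⟨e⟩ h => ObjectProperty.prop_of_iso _ e h
  zero _ hX _ _ _ := hX.eq_of_src _ _
  biprod X Y hX hY N f hN := by
    ext
    · simp [hX (biprod.inl ≫ f) hN]
    · simp [hY (biprod.inr ≫ f) hN]
  summand X Y h N f hN := by
    rw [← Category.id_comp f, ← biprod.inl_fst (X := X) (Y := Y), Category.assoc,
      h (biprod.fst ≫ f) hN, comp_zero]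
  suspension X := ⟨ObjectProperty.le_shift _ 1 _, fun h => ObjectProperty.prop_of_iso _
    (shiftShiftNeg X (1 : ℤ)) (ObjectProperty.le_shift _ (-1) _ h)⟩

lemma isStableAdditive_rightOrthogonal (𝒩 : ObjectProperty C) [𝒩.IsTriangulated] :
    IsStableAdditive 𝒩.rightOrthogonal where
  of_iso _ _ := fun ⟨e⟩ h => ObjectProperty.prop_of_iso _ e h
  zero _ hX _ _ _ := hX.eq_of_tgt _ _
  biprod X Y hX hY N f hN := by
    ext
    · simp [hX (f ≫ biprod.fst) hN]
    · simp [hY (f ≫ biprod.snd) hN]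
  summand X Y h N f hN := by
    rw [← Category.comp_id f, ← biprod.inl_fst (X := X) (Y := Y), ← Category.assoc,
      h (f ≫ biprod.inl) hN, zero_comp]
  suspension X := ⟨ObjectProperty.le_shift _ 1 _, fun h => ObjectProperty.prop_of_iso _
    (shiftShiftNeg X (1 : ℤ)) (ObjectProperty.le_shift _ (-1) _ h)⟩

/-- The left and right orthogonals of a triangulated subcategory that is both coreflective and
reflective form a balanced pair. -/
theorem isBalancedPair_of_orthogonal [𝒩.IsTriangulated]
    (hP : ∀ A : C, ∃ (P N : C) (f : P ⟶ A) (g : A ⟶ N) (h : N ⟶ P⟦(1 : ℤ)⟧),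
      𝒩.leftOrthogonal P ∧ 𝒩 N ∧ Triangle.mk f g h ∈ distTriang C)
    (hI : ∀ A : C, ∃ (N I : C) (f : N ⟶ A) (g : A ⟶ I) (h : I ⟶ N⟦(1 : ℤ)⟧),
      𝒩 N ∧ 𝒩.rightOrthogonal I ∧ Triangle.mk f g h ∈ distTriang C) :
    IsBalancedPair 𝒩.leftOrthogonal 𝒩.rightOrthogonal := by
  have hl := isStableAdditive_leftOrthogonal 𝒩
  have hr := isStableAdditive_rightOrthogonal 𝒩
  have hPI : ∀ A : C, ∃ (K P : C) (f : K ⟶ P) (g : P ⟶ A) (h : A ⟶ K⟦(1 : ℤ)⟧),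
      𝒩.leftOrthogonal P ∧ Triangle.mk f g h ∈ lowerClass 𝒩.leftOrthogonal := fun A => by
    obtain ⟨P, N, f, g, h, hP, hN, hT⟩ := hP A
    refine ⟨_, P, _, f, _, hP, (mem_lowerClass_iff hl _).2 ⟨inv_rot_of_distTriang _ hT, ?_⟩⟩
    -- The last map is phantom because its target is a shift of `N`, which receives no nonzero map
    -- from the left orthogonal.
    exact fun Q hQ k => hQ _ (𝒩.le_shift 1 _ (𝒩.le_shift (-1) _ hN))
  have hIP : ∀ A : C, ∃ (I K : C) (f : A ⟶ I) (g : I ⟶ K) (h : K ⟶ A⟦(1 : ℤ)⟧),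
      𝒩.rightOrthogonal I ∧ Triangle.mk f g h ∈ upperClass 𝒩.rightOrthogonal := fun A => by
    obtain ⟨N, I, f, g, h, hN, hI, hT⟩ := hI A
    refine ⟨I, _, g, h, _, hI, (mem_upperClass_iff hr _).2 ⟨rot_of_distTriang _ hT, ?_⟩⟩
    exact fun J hJ k => hJ _ (𝒩.le_shift 1 _ hN)
  have hle : 𝒩.leftOrthogonal ≤ projectives (lowerClass 𝒩.leftOrthogonal) := fun P hP T hT =>
    ⟨(hT.2 P hP).1, fun k => ⟨fun hk => by
      obtain ⟨g, hg⟩ := T.coyoneda_exact₂ hT.1 k hk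
      exact ⟨g, hg.symm⟩, by
      rintro ⟨g, rfl⟩
      simp [comp_distTriang_mor_zero₁₂ _ hT.1]⟩, (hT.2 P hP).2⟩
  have hle' : 𝒩.rightOrthogonal ≤ injectives (upperClass 𝒩.rightOrthogonal) := fun I hI T hT =>
    ⟨(hT.2 I hI).1, fun k => ⟨fun hk => by
      obtain ⟨g, hg⟩ := T.yoneda_exact₂ hT.1 k hk
      exact ⟨g, hg.symm⟩, by
      rintro ⟨g, rfl⟩
      simp [reassoc_of% comp_distTriang_mor_zero₁₂ _ hT.1]⟩, (hT.2 I hI).2⟩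
  exact
    { left := hl
      right := hr
      class_eq := by
        ext T
        rw [mem_lowerClass_iff hl, mem_upperClass_iff hr]
        refine and_congr_right fun hT => ⟨fun h I hI k => ?_, fun h P hP k => ?_⟩
        -- A phantom out of `T.obj₃` vanishes on the resolution `P`, so it factors through `N`, and
        -- `N` has no nonzero map to `I`.
        · obtain ⟨P, N, f, g, e, hP, hN, hT'⟩ := hP T.obj₃
          obtain ⟨l, hl⟩ : ∃ l : N ⟶ T.obj₁⟦(1 : ℤ)⟧, T.mor₃ = g ≫ l :=
            Triangle.yoneda_exact₂ _ hT' T.mor₃ (h P hP f)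
          rw [hl, Category.assoc, hI (l ≫ k) hN, comp_zero]
        · obtain ⟨N, I, f, g, e, hN, hI, hT'⟩ := hI (T.obj₁⟦(1 : ℤ)⟧)
          obtain ⟨l, hl⟩ : ∃ l : T.obj₃ ⟶ N, T.mor₃ = l ≫ f :=
            Triangle.coyoneda_exact₂ _ hT' T.mor₃ (h I hI g)
          rw [hl, ← Category.assoc]
          exact (hP (k ≫ l) hN).symm ▸ zero_comp
      projectives_eq := by
        refine le_antisymm hle fun P hP => ?_
        obtain ⟨K, Q, f, g, h, hQ, hT⟩ := hPI P
        -- Relative projectivity splits the resolution, so `P` is a retract of an object of the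
        -- orthogonal.
        obtain ⟨k, hk⟩ : ∃ k : P ⟶ Q, k ≫ g = 𝟙 P := (hP _ hT).2.2 (𝟙 P)
        intro N l hN
        rw [← Category.id_comp l, ← hk, Category.assoc, hQ (g ≫ l) hN, comp_zero]
      injectives_eq := by
        refine le_antisymm hle' fun I hI => ?_
        obtain ⟨J, K, f, g, h, hJ, hT⟩ := hIP I
        obtain ⟨k, hk⟩ : ∃ k : J ⟶ I, f ≫ k = 𝟙 I := (hI _ hT).2.2 (𝟙 I)
        intro N l hN
        rw [← Category.comp_id l, ← hk, ← Category.assoc, hJ (l ≫ f) hN, zero_comp]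
      enoughProjectives := fun A => by
        obtain ⟨K, Q, f, g, h, hQ, hT⟩ := hPI A
        exact ⟨K, Q, f, g, h, hle Q hQ, hT⟩
      enoughInjectives := fun A => by
        obtain ⟨J, K, f, g, h, hJ, hT⟩ := hIP A
        exact ⟨J, K, f, g, h, hle' J hJ, hT⟩ }

end ProperClass

/-! ### The extriangulated structure, and obstructions to being exact or triangulated. -/

section Extriangulated

/-- This comes from the triangle `A ⟶ 0 ⟶ ΣA` of the hypothetical triangulated structure. Its
suspension may differ from any given one, so only the conflation is retained. -/
lemma exists_realizes_of_isTriangulated {C : Type u} [Category.{v} C] [Preadditive C]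
    [HasZeroObject C] (𝒟 : ExtData.{w} C) (h : 𝒟.IsTriangulated) (A : C) :
    ∃ (Z X : C) (x : A ⟶ Z) (y : Z ⟶ X) (δ : 𝒟.Ext X A), IsZero Z ∧ 𝒟.Realizes x y δ := by
  obtain ⟨s, hs, p, _, θ, -, -, hθ⟩ := h
  have hT := @contractible_distinguished₂ C _ _ s _ hs p A
  refine ⟨_, _, _, _, (θ _ A).symm (𝟙 _), isZero_zero C, (hθ 0 0 _).2 ?_⟩
  rw [AddEquiv.apply_symm_apply]
  exact hT

variable {C : Type u} [Category.{v} C] [Preadditive C] [HasZeroObject C] [HasShift C ℤ]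
  [∀ n : ℤ, (shiftFunctor C n).Additive] [Pretriangulated C]

/-- Changing the signs of the first two morphisms of a triangle. -/
def triangleNegNegIso {X Y Z : C} (a : X ⟶ Y) (b : Y ⟶ Z) (c : Z ⟶ X⟦(1 : ℤ)⟧) :
    Triangle.mk (-a) (-b) c ≅ Triangle.mk a b c :=
  Triangle.isoMk _ _ (Iso.refl X)
    (show Y ≅ Y from ⟨-𝟙 _, -𝟙 _, by simp, by simp⟩) (Iso.refl Z)
    (by change (-a) ≫ (-𝟙 Y) = 𝟙 X ≫ a; simp)
    (by change (-b) ≫ 𝟙 Z = (-𝟙 Y) ≫ b; simp)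
    (by change c ≫ (𝟙 X)⟦(1 : ℤ)⟧' = 𝟙 Z ≫ c; simp)

/-- The dual form of the octahedral axiom. -/
lemma exists_octahedron_op [CategoryTheory.IsTriangulated C] {A B D F G : C}
    {f' : D ⟶ A} {f : A ⟶ B} {δ : B ⟶ D⟦(1 : ℤ)⟧} (h₁ : Triangle.mk f' f δ ∈ distTriang C)
    {g' : F ⟶ B} {g : B ⟶ G} {δ' : G ⟶ F⟦(1 : ℤ)⟧} (h₂ : Triangle.mk g' g δ' ∈ distTriang C) :
    ∃ (H : C) (d : D ⟶ H) (e : H ⟶ F) (h' : H ⟶ A) (δ'' : G ⟶ H⟦(1 : ℤ)⟧),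
      d ≫ h' = f' ∧ h' ≫ f = e ≫ g' ∧ Triangle.mk h' (f ≫ g) δ'' ∈ distTriang C ∧
      Triangle.mk d e (g' ≫ δ) ∈ distTriang C ∧ δ'' ≫ e⟦(1 : ℤ)⟧' = δ' ∧
      δ ≫ d⟦(1 : ℤ)⟧' = g ≫ δ'' := by
  obtain ⟨H, h', δ'', h₃⟩ := distinguished_cocone_triangle₁ (f ≫ g)
  -- The ordinary octahedron is applied to `f` and `g` with cones `ΣD`, `ΣF` and `ΣH`; its morphisms
  -- desuspend because `Σ` is fully faithful.
  obtain ⟨o⟩ := IsTriangulated.octahedron_axiom (rfl : f ≫ g = f ≫ g)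
    (rot_of_distTriang _ h₁) (rot_of_distTriang _ h₂) (rot_of_distTriang _ h₃)
  obtain ⟨m₁, m₃, c₁, c₂, c₃, c₄, mem⟩ := o
  obtain ⟨d, rfl⟩ : ∃ d : D ⟶ H, d⟦(1 : ℤ)⟧' = m₁ := (shiftFunctor C (1 : ℤ)).map_surjective m₁
  obtain ⟨e, rfl⟩ : ∃ e : H ⟶ F, e⟦(1 : ℤ)⟧' = m₃ := (shiftFunctor C (1 : ℤ)).map_surjective m₃
  change d⟦(1 : ℤ)⟧' ≫ (-h'⟦(1 : ℤ)⟧') = -f'⟦(1 : ℤ)⟧' at c₂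
  change (-h'⟦(1 : ℤ)⟧') ≫ f⟦(1 : ℤ)⟧' = e⟦(1 : ℤ)⟧' ≫ (-g'⟦(1 : ℤ)⟧') at c₄
  change Triangle.mk (d⟦(1 : ℤ)⟧') (e⟦(1 : ℤ)⟧') ((-g'⟦(1 : ℤ)⟧') ≫ δ⟦(1 : ℤ)⟧') ∈ distTriang C at mem
  refine ⟨H, d, e, h', δ'', ?_, ?_, h₃, ?_, c₃, c₁⟩
  · apply (shiftFunctor C (1 : ℤ)).map_injective
    rw [Preadditive.comp_neg, neg_inj] at c₂
    rw [Functor.map_comp, c₂]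
  · apply (shiftFunctor C (1 : ℤ)).map_injective
    rw [Preadditive.comp_neg, Preadditive.neg_comp, neg_inj] at c₄
    rw [Functor.map_comp, c₄, Functor.map_comp]
  -- Three rotations suspend the triangle and negate all three maps. The first two signs are removed
  -- by an isomorphism; the third matches the sign in `mem`.
  · rw [Pretriangulated.rotate_distinguished_triangle,
      Pretriangulated.rotate_distinguished_triangle, Pretriangulated.rotate_distinguished_triangle]
    refine isomorphic_distinguished _ mem _ (triangleNegNegIso _ _ _ ≪≫ eqToIso ?_)
    change Triangle.mk (d⟦(1 : ℤ)⟧') (e⟦(1 : ℤ)⟧') (-(g' ≫ δ)⟦(1 : ℤ)⟧') = _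
    rw [Functor.map_comp, Preadditive.neg_comp]

variable {𝒳 : ObjectProperty C}

theorem isExtriangulated_lowerClass [CategoryTheory.IsTriangulated C] (h𝒳 : IsStableAdditive 𝒳)
    (hξ : IsProperClass (lowerClass 𝒳)) : hξ.extData.IsExtriangulated where
  additive_left :=
    { map_add := fun {X Y f g} => by
        ext A δ
        exact Subtype.ext (Preadditive.add_comp _ _ _ _ _ _) }
  additive_right X :=
    { map_add := fun {A A' f g} => by
        ext δ
        refine Subtype.ext ?_
        change (show hξ.extGroup X.unop A from δ).1 ≫ (f + g)⟦(1 : ℤ)⟧' = _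
        rw [Functor.map_add, Preadditive.comp_add]
        rfl }
  exists_realization δ := by
    obtain ⟨B, x, y, h⟩ := distinguished_cocone_triangle₂ δ.1
    exact ⟨B, x, y, h⟩
  realizes_iff {X A B B'} δ x y x' y' h := by
    constructor
    · intro h'
      obtain ⟨b, hb₁, hb₂⟩ := complete_distinguished_triangle_morphism₂ _ _ h h' (𝟙 A) (𝟙 X)
        (by change δ.1 ≫ (𝟙 A)⟦(1 : ℤ)⟧' = 𝟙 X ≫ δ.1; simp)
      let φ : Triangle.mk x y δ.1 ⟶ Triangle.mk x' y' δ.1 :=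
        { hom₁ := 𝟙 A, hom₂ := b, hom₃ := 𝟙 X, comm₁ := hb₁, comm₂ := hb₂
          comm₃ := by change δ.1 ≫ (𝟙 A)⟦(1 : ℤ)⟧' = 𝟙 X ≫ δ.1; simp }
      have hb : IsIso φ.hom₂ := isIso₂_of_isIso₁₃ φ h h' (inferInstanceAs (IsIso (𝟙 A)))
        (inferInstanceAs (IsIso (𝟙 X)))
      exact ⟨@asIso _ _ B B' b hb, hb₁.trans (Category.id_comp _), hb₂.symm.trans (Category.comp_id _)⟩
    · rintro ⟨b, rfl, rfl⟩
      refine isomorphic_distinguished _ h _ (Triangle.isoMk _ _ (Iso.refl A) b.symm (Iso.refl X)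
        ?_ ?_ ?_)
      · change (x ≫ b.hom) ≫ b.inv = 𝟙 A ≫ x
        simp
      · change y' ≫ 𝟙 X = b.inv ≫ b.hom ≫ y'
        simp
      · change δ.1 ≫ (𝟙 A)⟦(1 : ℤ)⟧' = 𝟙 X ≫ δ.1
        simp
  realization δ δ' x y x' y' a c h h' hac :=
    complete_distinguished_triangle_morphism₂ _ _ h h' a c (congr_arg Subtype.val hac)
  realizes_zero X A := binaryBiproductTriangle_distinguished A X
  realizes_directSum {X A B X' A' B'} δ δ' x y x' y' h h' := by
    refine isomorphic_distinguished _ (biprodTriangle_distinguished _ _ h h') _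
      (eqToIso ?_)
    change Triangle.mk (biprod.map x x') (biprod.map y y')
      ((biprod.fst ≫ δ.1) ≫ (biprod.inl : A ⟶ A ⊞ A')⟦(1 : ℤ)⟧' +
        (biprod.snd ≫ δ'.1) ≫ (biprod.inr : A' ⟶ A ⊞ A')⟦(1 : ℤ)⟧') =
      Triangle.mk (biprod.map x x') (biprod.map y y')
        (biprod.desc (δ.1 ≫ (biprod.inl : A ⟶ A ⊞ A')⟦(1 : ℤ)⟧')
        (δ'.1 ≫ (biprod.inr : A' ⟶ A ⊞ A')⟦(1 : ℤ)⟧'))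
    rw [biprod.desc_eq, Category.assoc, Category.assoc]
  et3 δ δ' x y x' y' a b h h' hab := by
    obtain ⟨c, hc₁, hc₂⟩ := complete_distinguished_triangle_morphism _ _ h h' a b hab
    exact ⟨c, hc₁, Subtype.ext hc₂⟩
  et3_op δ δ' x y x' y' b c h h' hbc := by
    obtain ⟨a, ha₁, ha₂⟩ := complete_distinguished_triangle_morphism₁ _ _ h h' b c hbc
    exact ⟨a, ha₁, Subtype.ext ha₂⟩
  et4 {A B D F G} δ δ' f f' g g' h h' := by
    obtain ⟨H, v, w, h''⟩ := distinguished_cocone_triangle (f ≫ g)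
    obtain ⟨o⟩ := IsTriangulated.octahedron_axiom (rfl : f ≫ g = f ≫ g) h h' h''
    have hδ : Phantom 𝒳 δ.1 := (mem_extGroup_lowerClass_iff h𝒳 hξ _).1 δ.2
    have hδ' : Phantom 𝒳 δ'.1 := (mem_extGroup_lowerClass_iff h𝒳 hξ _).1 δ'.2
    have c₂ : o.m₁ ≫ w = δ.1 := o.comm₂
    have c₄ : w ≫ f⟦(1 : ℤ)⟧' = o.m₃ ≫ δ'.1 := o.comm₄
    have hw : Phantom 𝒳 w := fun P hP k => by
      -- After pushing along `f`, `k ≫ w` factors through the phantom `δ'` and dies. It therefore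
      -- factors through `δ`, which is phantom too.
      obtain ⟨l, hl⟩ : ∃ l : P ⟶ D, k ≫ w = l ≫ δ.1 := Triangle.coyoneda_exact₁ _ h (k ≫ w) (by
        change (k ≫ w) ≫ f⟦(1 : ℤ)⟧' = 0
        rw [Category.assoc, c₄, (hδ'.precomp _) P hP])
      rw [hl, hδ P hP]
    exact ⟨H, v, o.m₁, o.m₃, ⟨w, (mem_extGroup_lowerClass_iff h𝒳 hξ _).2 hw⟩, o.comm₁, o.comm₃,
      h'', o.mem, Subtype.ext c₂, Subtype.ext c₄⟩
  et4_op {A B D F G} δ δ' f' f g' g h h' := by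
    obtain ⟨H, d, e, k, w, c₁, c₂, h₁, h₂, c₃, c₄⟩ := exists_octahedron_op h h'
    have hδ : Phantom 𝒳 δ.1 := (mem_extGroup_lowerClass_iff h𝒳 hξ _).1 δ.2
    have hδ' : Phantom 𝒳 δ'.1 := (mem_extGroup_lowerClass_iff h𝒳 hξ _).1 δ'.2
    have hw : Phantom 𝒳 w := fun P hP l => by
      -- Since `δ'` is phantom, `l` lifts through `g`, and `g ≫ w` is a pushforward of the phantom
      -- `δ`.
      obtain ⟨m, hm⟩ : ∃ m : P ⟶ B, l = m ≫ g := Triangle.coyoneda_exact₃ _ h' l (hδ' P hP l)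
      rw [hm, Category.assoc, ← c₄, (hδ.postcomp _) P hP]
    exact ⟨H, d, e, k, ⟨w, (mem_extGroup_lowerClass_iff h𝒳 hξ _).2 hw⟩, c₁, c₂, h₁, h₂,
      Subtype.ext c₃, Subtype.ext c₄⟩

/-- If the extriangulated category of a class `ξ_𝒳` is triangulated, then `𝒳` vanishes. -/
theorem isZero_of_isTriangulated (h𝒳 : IsStableAdditive 𝒳)
    (hξ : IsProperClass (lowerClass 𝒳)) (h : hξ.extData.IsTriangulated) (P : C) (hP : 𝒳 P) :
    IsZero P := by
  obtain ⟨Z, X, x, y, δ, hZ, hT⟩ := exists_realizes_of_isTriangulated _ h (P⟦(-1 : ℤ)⟧)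
  have hδ : Phantom 𝒳 δ.1 := (mem_extGroup_lowerClass_iff h𝒳 hξ _).1 δ.2
  -- As the middle term is zero, every map to `ΣA` factors through `δ`. With `A = Σ⁻¹P` this
  -- includes the isomorphism from `P`, which the phantom `δ` then kills.
  obtain ⟨l, hl⟩ : ∃ l : P ⟶ X, (shiftNegShift P (1 : ℤ)).inv = l ≫ δ.1 :=
    Triangle.coyoneda_exact₁ _ hT (shiftNegShift P (1 : ℤ)).inv
      (((shiftFunctor C (1 : ℤ)).map_isZero hZ).eq_of_tgt _ _)
  rw [hδ P hP] at hl
  rw [IsZero.iff_id_eq_zero, ← (shiftNegShift P (1 : ℤ)).inv_hom_id, hl, zero_comp]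

/-- If the extriangulated category of a class `ξ_𝒳` is exact, then all `𝒳`-phantom morphisms
vanish. -/
theorem phantom_eq_zero_of_isExact (h𝒳 : IsStableAdditive 𝒳)
    (hξ : IsProperClass (lowerClass 𝒳)) (h : hξ.extData.IsExact) {X A : C}
    (δ : X ⟶ A⟦(1 : ℤ)⟧) (hδ : Phantom 𝒳 δ) : δ = 0 := by
  obtain ⟨B, x, y, hT⟩ := distinguished_cocone_triangle₂ δ
  obtain ⟨hc⟩ := h.cokernel (ShortComplex.mk x y (comp_distTriang_mor_zero₁₂ _ hT))
    ⟨⟨δ, (mem_extGroup_lowerClass_iff h𝒳 hξ _).2 hδ⟩, hT⟩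
  have hy : Epi y := Cofork.IsColimit.epi hc
  exact Triangle.mor₃_eq_zero_of_epi₂ _ hT hy

end Extriangulated

/-! ### Homotopy limits of towers with phantom transition maps. -/

section Tower

section

variable {C : Type u} [Category.{v} C] [HasProductsOfShape ℕ C] {X : ℕ → C}
  (p : ∀ n, X (n + 1) ⟶ X n)

/-- The endomorphism of `∏ X n` given by the transition morphisms of a tower. -/
def towerShift : ∏ᶜ X ⟶ ∏ᶜ X := Pi.lift fun n => Pi.π X (n + 1) ≫ p n

@[simp]
lemma towerShift_π (n : ℕ) : towerShift p ≫ Pi.π X n = Pi.π X (n + 1) ≫ p n := by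
  simp [towerShift]

@[simp]
lemma towerShift_π_assoc (n : ℕ) {Z : C} (h : X n ⟶ Z) :
    towerShift p ≫ Pi.π X n ≫ h = Pi.π X (n + 1) ≫ p n ≫ h := by
  simp [towerShift]

end

variable {C : Type u} [Category.{v} C] [Preadditive C]

/-- The components of a section of `𝟙 - s`, for the shift `s` of a constant product. -/
def constSectionAux [HasProductsOfShape ℕ C] (A : C) : ℕ → ((∏ᶜ fun _ : ℕ => A) ⟶ A)
  | 0 => 0
  | n + 1 => constSectionAux A n - Pi.π (fun _ : ℕ => A) n

/-- Solve `σ_n - σ_{n+1} = π_n` recursively, starting from `σ_0 = 0`. -/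
lemma exists_section_one_sub_towerShift [HasProductsOfShape ℕ C] (A : C) :
    ∃ σ : (∏ᶜ fun _ : ℕ => A) ⟶ ∏ᶜ fun _ : ℕ => A,
      σ ≫ (𝟙 _ - towerShift (X := fun _ => A) fun _ => 𝟙 A) = 𝟙 _ := by
  refine ⟨Pi.lift (constSectionAux A), Pi.hom_ext _ _ fun n => ?_⟩
  simp [Preadditive.sub_comp, Preadditive.comp_sub, constSectionAux]

variable [HasZeroObject C] [HasShift C ℤ] [∀ n : ℤ, (shiftFunctor C n).Additive]
  [Pretriangulated C]

/-- The homotopy limit of a constant tower is its value: `𝟙 - s` is a split epimorphism, so `a` is a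
monomorphism, and all projections agree on it. The diagonal gives the inverse of the projection. -/
lemma nonempty_iso_of_one_sub_towerShift [HasProductsOfShape ℕ C] {A N : C}
    {a : N ⟶ ∏ᶜ fun _ : ℕ => A} {h : (∏ᶜ fun _ : ℕ => A) ⟶ N⟦(1 : ℤ)⟧}
    (hT : Triangle.mk a (𝟙 _ - towerShift (X := fun _ => A) fun _ => 𝟙 A) h ∈ distTriang C) :
    Nonempty (N ≅ A) := by
  obtain ⟨σ, hσ⟩ := exists_section_one_sub_towerShift A
  have hab : a ≫ (𝟙 _ - towerShift (X := fun _ => A) fun _ => 𝟙 A) = 0 :=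
    comp_distTriang_mor_zero₁₂ _ hT
  have hbh : (𝟙 _ - towerShift (X := fun _ => A) fun _ => 𝟙 A) ≫ h = 0 :=
    comp_distTriang_mor_zero₂₃ _ hT
  have h0 : h = 0 := by
    rw [← Category.id_comp h, ← hσ, Category.assoc, hbh, comp_zero]
  have ha : Mono a := Triangle.mono₁ _ hT h0
  have hdiag : Pi.lift (fun _ : ℕ => 𝟙 A) ≫
      (𝟙 _ - towerShift (X := fun _ => A) fun _ => 𝟙 A) = 0 := Pi.hom_ext _ _ fun n => by
    simp [Preadditive.sub_comp, Preadditive.comp_sub]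
  obtain ⟨u, hu⟩ : ∃ u : A ⟶ N, Pi.lift (fun _ : ℕ => 𝟙 A) = u ≫ a :=
    Triangle.coyoneda_exact₂ _ hT _ hdiag
  have hπ : ∀ n, a ≫ Pi.π (fun _ : ℕ => A) n = a ≫ Pi.π (fun _ : ℕ => A) 0 := fun n => by
    induction n with
    | zero => rfl
    | succ n ih =>
      have := congr($hab ≫ Pi.π (fun _ : ℕ => A) n)
      simp only [Preadditive.comp_sub, Category.comp_id, Preadditive.sub_comp, Category.assoc,
        towerShift_π, zero_comp, sub_eq_zero] at this
      rw [← ih, this]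
  refine ⟨a ≫ Pi.π (fun _ : ℕ => A) 0, u, ?_, ?_⟩
  · rw [← cancel_mono a, Category.assoc, ← hu]
    refine Pi.hom_ext _ _ fun n => ?_
    simp [hπ n]
  · rw [← reassoc_of% hu]
    simp

/-- The shift `s` is phantom, so `𝟙 - s` acts as the identity on maps from `P` and from `ΣP` to the
product. Hence the homotopy limit receives no nonzero map from `P`. -/
lemma eq_zero_of_phantom_towerShift [HasProductsOfShape ℕ C] (𝒢 : ObjectProperty C)
    [𝒢.IsStableUnderShift ℤ] {X : ℕ → C} (p : ∀ n, X (n + 1) ⟶ X n)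
    (hp : ∀ n, Phantom 𝒢 (p n)) {N : C} {a : N ⟶ ∏ᶜ X} {h : ∏ᶜ X ⟶ N⟦(1 : ℤ)⟧}
    (hT : Triangle.mk a (𝟙 _ - towerShift p) h ∈ distTriang C) {P : C} (hP : 𝒢 P)
    (k : P ⟶ N) : k = 0 := by
  have hs : Phantom 𝒢 (towerShift p) := fun Q hQ l => Pi.hom_ext _ _ fun n => by
    simpa using hp n Q hQ (l ≫ Pi.π X (n + 1))
  have hab : a ≫ (𝟙 _ - towerShift p) = 0 := comp_distTriang_mor_zero₁₂ _ hT
  have hbh : (𝟙 _ - towerShift p) ≫ h = 0 := comp_distTriang_mor_zero₂₃ _ hT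
  have hka : k ≫ a = 0 := by
    have := congr(k ≫ $hab)
    rwa [Preadditive.comp_sub, Preadditive.comp_sub, Category.comp_id, ← Category.assoc,
      hs P hP, sub_zero, comp_zero] at this
  obtain ⟨g, hg⟩ : ∃ g : P⟦(1 : ℤ)⟧ ⟶ ∏ᶜ X, k⟦(1 : ℤ)⟧' = g ≫ h :=
    Triangle.coyoneda_exact₁ _ hT (k⟦(1 : ℤ)⟧') (by
      change k⟦(1 : ℤ)⟧' ≫ a⟦(1 : ℤ)⟧' = 0
      rw [← Functor.map_comp, hka, Functor.map_zero])
  have hg' : g ≫ (𝟙 _ - towerShift p) = g := by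
    rw [Preadditive.comp_sub, Category.comp_id, hs _ (𝒢.le_shift 1 _ hP), sub_zero]
  refine (shiftFunctor C (1 : ℤ)).map_injective ?_
  rw [hg, ← hg', Category.assoc, hbh, comp_zero, Functor.map_zero]

lemma trW_piMap (𝒥 : ObjectProperty C) [HasProductsOfShape ℕ C]
    (h𝒥 : ∀ X : ℕ → C, (∀ n, 𝒥 (X n)) → 𝒥 (∏ᶜ X)) {X Y : ℕ → C} (f : ∀ n, X n ⟶ Y n)
    (hf : ∀ n, 𝒥.trW (f n)) : 𝒥.trW (Limits.Pi.map f) :=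
  ObjectProperty.trW.mk _ (productTriangle_distinguished _
      (fun j => (hf j).choose_spec.choose_spec.choose_spec.choose))
    (h𝒥 _ (fun j => (hf j).choose_spec.choose_spec.choose_spec.choose_spec))

/-- The iterated sources of a family of morphisms `i M : F M ⟶ M`, starting at `A`. -/
def iterSource (F : C → C) (A : C) : ℕ → C
  | 0 => A
  | n + 1 => F (iterSource F A n)

/-- The composite `F^n A ⟶ A`. -/
def iterSourceMap (F : C → C) (i : ∀ M, F M ⟶ M) (A : C) : ∀ n, iterSource F A n ⟶ A
  | 0 => 𝟙 A
  | n + 1 => i (iterSource F A n) ≫ iterSourceMap F i A n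

/-- Every object is `𝒥`-locally equivalent to an object without nonzero morphisms from `𝒢`, if
every object is `𝒥`-locally equivalent to another one by a `𝒢`-phantom morphism. -/
theorem exists_trW_of_phantom [CategoryTheory.IsTriangulated C] [HasProductsOfShape ℕ C]
    (𝒢 𝒥 : ObjectProperty C) [𝒢.IsStableUnderShift ℤ] [𝒥.IsTriangulated]
    (h𝒥 : ∀ X : ℕ → C, (∀ n, 𝒥 (X n)) → 𝒥 (∏ᶜ X))
    (hi : ∀ M : C, ∃ (F : C) (i : F ⟶ M), 𝒥.trW i ∧ Phantom 𝒢 i) (A : C) :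
    ∃ (N : C) (f : N ⟶ A), 𝒥.trW f ∧ ∀ P, 𝒢 P → ∀ k : P ⟶ N, k = 0 := by
  choose F i hi hi' using hi
  obtain ⟨N, a, h, hT⟩ := distinguished_cocone_triangle₁
    (𝟙 _ - towerShift (X := iterSource F A) fun n => i (iterSource F A n))
  obtain ⟨N', a', h', hT'⟩ := distinguished_cocone_triangle₁
    (𝟙 _ - towerShift (X := fun _ => A) fun _ => 𝟙 A)
  obtain ⟨e⟩ := nonempty_iso_of_one_sub_towerShift hT'
  have hf : ∀ n, 𝒥.trW (iterSourceMap F i A n) := fun n => by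
    induction n with
    | zero => exact 𝒥.trW.id_mem A
    | succ n ih => exact 𝒥.trW.comp_mem _ _ (hi _) ih
  have hπ := trW_piMap 𝒥 h𝒥 _ hf
  have hcomm : (𝟙 _ - towerShift (X := iterSource F A) fun n => i (iterSource F A n)) ≫
      Limits.Pi.map (iterSourceMap F i A) = Limits.Pi.map (iterSourceMap F i A) ≫
        (𝟙 _ - towerShift (X := fun _ => A) fun _ => 𝟙 A) := Pi.hom_ext _ _ fun n => by
    simp [Preadditive.sub_comp, Preadditive.comp_sub, iterSourceMap]
    exact towerShift_π_assoc _ n _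
  -- The maps `F^n A ⟶ A` compare the tower with the constant tower at `A`; the induced map of
  -- homotopy limits can be chosen in `𝒥.trW`.
  obtain ⟨c, hc, -, -⟩ := MorphismProperty.compatible_with_triangulation (W := 𝒥.trW)
    _ _ (rot_of_distTriang _ hT) (rot_of_distTriang _ hT') _ _ hπ hπ hcomm
  obtain ⟨d, rfl⟩ : ∃ d : N ⟶ N', d⟦(1 : ℤ)⟧' = c := (shiftFunctor C (1 : ℤ)).map_surjective c
  refine ⟨N, d ≫ e.hom, ?_, fun P hP k =>
    eq_zero_of_phantom_towerShift 𝒢 _ (fun n => hi' _) hT hP k⟩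
  exact 𝒥.trW.comp_mem _ _ ((MorphismProperty.IsCompatibleWithShift.iff 𝒥.trW d 1).1 hc)
    (𝒥.trW_of_isIso _)

-- Dual of `exists_trW_of_phantom`, read in the opposite triangulated category, where coproducts
-- become products.
open Opposite Pretriangulated.Opposite in
theorem exists_trW_of_cophantom [CategoryTheory.IsTriangulated C] [HasCoproductsOfShape ℕ C]
    (𝒢 𝒬 : ObjectProperty C) [𝒢.IsStableUnderShift ℤ] [𝒬.IsTriangulated]
    [𝒬.IsClosedUnderIsomorphisms]
    (h𝒬 : ∀ X : ℕ → C, (∀ n, 𝒬 (X n)) → 𝒬 (∐ X))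
    (hi : ∀ M : C, ∃ (F : C) (i : M ⟶ F), 𝒬.trW i ∧ ∀ J, 𝒢 J → ∀ k : F ⟶ J, i ≫ k = 0) (A : C) :
    ∃ (N : C) (f : A ⟶ N), 𝒬.trW f ∧ ∀ J, 𝒢 J → ∀ k : N ⟶ J, k = 0 := by
  have : HasProductsOfShape ℕ Cᵒᵖ := inferInstance
  obtain ⟨N, f, hf, hN⟩ := exists_trW_of_phantom 𝒢.op 𝒬.op (fun X hX =>
    𝒬.prop_of_iso (opCoproductIsoProduct fun n => (X n).unop).symm.unop (h𝒬 _ hX)) (fun M => by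
      obtain ⟨F, i, hi, hi'⟩ := hi M.unop
      exact ⟨op F, i.op, (𝒬.trW_op_iff).2 hi, fun P hP k => Quiver.Hom.unop_inj (hi' _ hP k.unop)⟩)
    (op A)
  exact ⟨N.unop, f.unop, (𝒬.trW_op_iff).1 hf, fun J hJ k => Quiver.Hom.op_inj (hN (op J) hJ k.op)⟩

end Tower

/-! ### Termwise conditions, products and coproducts in the homotopy category. -/

section Homotopy

open scoped ZeroObject

variable {A : Type u} [Category.{v} A] [Abelian A]

/-- The complexes, viewed in the homotopy category, all of whose terms satisfy `Q`. -/
def termwise (Q : ObjectProperty A) : ObjectProperty (HomotopyCategory A (ComplexShape.up ℤ)) :=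
  fun X => ∀ n : ℤ, Q (X.as.X n)

/-- The complexes, viewed in the homotopy category, with zero differential and all of whose terms
satisfy `Q`. -/
def termwiseZero (Q : ObjectProperty A) :
    ObjectProperty (HomotopyCategory A (ComplexShape.up ℤ)) :=
  fun X => (∀ n : ℤ, Q (X.as.X n)) ∧ ∀ i j : ℤ, X.as.d i j = 0

instance (Q : ObjectProperty A) : (termwise Q).IsStableUnderShift ℤ where
  isStableUnderShiftBy n :=
    { le_shift X hX := by
        obtain ⟨K, rfl⟩ := X.quotient_obj_surjective
        rw [ObjectProperty.prop_shift_iff, HomotopyCategory.shift_quotient_obj]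
        exact fun m => hX (m + n) }

instance (Q : ObjectProperty A) : (termwiseZero Q).IsStableUnderShift ℤ where
  isStableUnderShiftBy n :=
    { le_shift X hX := by
        obtain ⟨K, rfl⟩ := X.quotient_obj_surjective
        rw [ObjectProperty.prop_shift_iff, HomotopyCategory.shift_quotient_obj]
        refine ⟨fun m => hX.1 (m + n), fun i j => ?_⟩
        have h : n.negOnePow • K.d (i + n) (j + n) = 0 := by
          rw [show K.d (i + n) (j + n) = 0 from hX.2 _ _, smul_zero]
        exact h }

lemma isTriangulated_termwise (Q : ObjectProperty A) [Q.IsClosedUnderIsomorphisms]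
    (h0 : ∀ X, IsZero X → Q X) (hQ : ∀ X Y, Q X → Q Y → Q (X ⊞ Y)) : (termwise Q).IsTriangulated :=
  have : (termwise Q).ContainsZero :=
    ⟨(HomotopyCategory.quotient A (ComplexShape.up ℤ)).obj 0,
      Functor.map_isZero _ (isZero_zero _), fun n => h0 _
        (Functor.map_isZero (HomologicalComplex.eval A (ComplexShape.up ℤ) n) (isZero_zero _))⟩
  have : (termwise Q).IsTriangulatedClosed₃ :=
    ⟨fun T hT h₁ h₂ => by
      obtain ⟨f : T.obj₁.as ⟶ T.obj₂.as, hf⟩ :=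
        (HomotopyCategory.quotient A (ComplexShape.up ℤ)).map_surjective T.mor₁
      refine ⟨_, fun n => ?_, ⟨Triangle.π₃.mapIso (isoTriangleOfIso₁₂ T _ hT
        (HomotopyCategory.mappingCone_triangleh_distinguished f) (Iso.refl _) (Iso.refl _) ?_)⟩⟩
      -- Each term of the mapping cone is a biproduct of terms of the two complexes.
      · have := HomologicalComplex.HasHomotopyCofiber.hasBinaryBiproduct f n (n + 1) rfl
        exact Q.prop_of_iso (HomologicalComplex.homotopyCofiber.XIsoBiprod f n (n + 1) rfl).symm
          (hQ _ _ (h₁ _) (h₂ _))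
      · exact ((Category.comp_id _).trans hf.symm).trans (Category.id_comp _).symm⟩
  { toIsTriangulatedClosed₂ := .of_isTriangulatedClosed₃ }

/-! ### Products and coproducts in the homotopy category -/

/-- A homotopy is a chain map out of the cylinder, so componentwise homotopies assemble by the
universal property of the product. The coproduct case uses the path object. -/
lemma nonempty_homotopy_pi {ι : Type*} {K : ι → CochainComplex A ℤ} [HasProduct K]
    {L : CochainComplex A ℤ} (f g : L ⟶ ∏ᶜ K)
    (h : ∀ i, Nonempty (Homotopy (f ≫ Pi.π K i) (g ≫ Pi.π K i))) : Nonempty (Homotopy f g) := by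
  let φ : L.cylinder ⟶ ∏ᶜ K := Pi.lift fun i => HomologicalComplex.cylinder.desc _ _ (h i).some
  have hf : HomologicalComplex.cylinder.ι₀ L ≫ φ = f := Pi.hom_ext _ _ fun i => by simp [φ]
  have hg : HomologicalComplex.cylinder.ι₁ L ≫ φ = g := Pi.hom_ext _ _ fun i => by simp [φ]
  rw [← hf, ← hg]
  exact ⟨(HomologicalComplex.cylinder.homotopy₀₁ L fun j => ⟨j - 1, by simp⟩).compRight φ⟩

lemma nonempty_homotopy_sigma {ι : Type*} {K : ι → CochainComplex A ℤ} [HasCoproduct K]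
    {L : CochainComplex A ℤ} (f g : ∐ K ⟶ L)
    (h : ∀ i, Nonempty (Homotopy (Sigma.ι K i ≫ f) (Sigma.ι K i ≫ g))) :
    Nonempty (Homotopy f g) := by
  let φ : ∐ K ⟶ L.pathObject :=
    Sigma.desc fun i => HomologicalComplex.pathObject.lift _ _ (h i).some
  have hf : φ ≫ HomologicalComplex.pathObject.π₀ L = f := Sigma.hom_ext _ _ fun i => by simp [φ]
  have hg : φ ≫ HomologicalComplex.pathObject.π₁ L = g := Sigma.hom_ext _ _ fun i => by simp [φ]
  rw [← hf, ← hg]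
  exact ⟨(HomologicalComplex.pathObject.homotopy₀₁ L fun j => ⟨j + 1, by simp⟩).compLeft φ⟩

/-- Products of complexes are products in the homotopy category. -/
def quotientPiIsLimit {ι : Type*} (K : ι → CochainComplex A ℤ) [HasProduct K] :
    IsLimit (Fan.mk ((HomotopyCategory.quotient A (ComplexShape.up ℤ)).obj (∏ᶜ K))
      fun i => (HomotopyCategory.quotient A (ComplexShape.up ℤ)).map (Pi.π K i)) :=
  Fan.IsLimit.mk _
    (fun s => (HomotopyCategory.quotient A (ComplexShape.up ℤ)).map
      (Pi.lift fun i => ((HomotopyCategory.quotient A (ComplexShape.up ℤ)).map_surjective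
        (X := s.pt.as) (Y := K i) (s.proj i)).choose))
    (fun s j => by
      refine ((HomotopyCategory.quotient A (ComplexShape.up ℤ)).map_comp _ _).symm.trans ?_
      rw [Pi.lift_π]
      exact ((HomotopyCategory.quotient A (ComplexShape.up ℤ)).map_surjective
        (X := s.pt.as) (Y := K j) (s.proj j)).choose_spec)
    (fun s m hm => by
      obtain ⟨m', hm'⟩ := (HomotopyCategory.quotient A (ComplexShape.up ℤ)).map_surjective
        (X := s.pt.as) (Y := ∏ᶜ K) m
      refine hm'.symm.trans ?_
      obtain ⟨h⟩ := nonempty_homotopy_pi m' (Pi.lift fun i =>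
        ((HomotopyCategory.quotient A (ComplexShape.up ℤ)).map_surjective
        (X := s.pt.as) (Y := K i) (s.proj i)).choose) (fun i =>
          ⟨HomotopyCategory.homotopyOfEq _ _ (by
            rw [Pi.lift_π, Functor.map_comp, hm']
            exact (hm i).trans ((HomotopyCategory.quotient A (ComplexShape.up ℤ)).map_surjective
              (X := s.pt.as) (Y := K i) (s.proj i)).choose_spec.symm)⟩)
      exact HomotopyCategory.eq_of_homotopy _ _ h)

/-- Coproducts of complexes are coproducts in the homotopy category. -/
def quotientSigmaIsColimit {ι : Type*} (K : ι → CochainComplex A ℤ) [HasCoproduct K] :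
    IsColimit (Cofan.mk ((HomotopyCategory.quotient A (ComplexShape.up ℤ)).obj (∐ K))
      fun i => (HomotopyCategory.quotient A (ComplexShape.up ℤ)).map (Sigma.ι K i)) :=
  Cofan.IsColimit.mk _
    (fun s => (HomotopyCategory.quotient A (ComplexShape.up ℤ)).map
      (Sigma.desc fun i => ((HomotopyCategory.quotient A (ComplexShape.up ℤ)).map_surjective
        (X := K i) (Y := s.pt.as) (s.inj i)).choose))
    (fun s j => by
      refine ((HomotopyCategory.quotient A (ComplexShape.up ℤ)).map_comp _ _).symm.trans ?_
      rw [Sigma.ι_desc]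
      exact ((HomotopyCategory.quotient A (ComplexShape.up ℤ)).map_surjective
        (X := K j) (Y := s.pt.as) (s.inj j)).choose_spec)
    (fun s m hm => by
      obtain ⟨m', hm'⟩ := (HomotopyCategory.quotient A (ComplexShape.up ℤ)).map_surjective
        (X := ∐ K) (Y := s.pt.as) m
      refine hm'.symm.trans ?_
      obtain ⟨h⟩ := nonempty_homotopy_sigma m' (Sigma.desc fun i =>
        ((HomotopyCategory.quotient A (ComplexShape.up ℤ)).map_surjective
        (X := K i) (Y := s.pt.as) (s.inj i)).choose) (fun i =>
          ⟨HomotopyCategory.homotopyOfEq _ _ (by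
            rw [Sigma.ι_desc, Functor.map_comp, hm']
            exact (hm i).trans ((HomotopyCategory.quotient A (ComplexShape.up ℤ)).map_surjective
              (X := K i) (Y := s.pt.as) (s.inj i)).choose_spec.symm)⟩)
      exact HomotopyCategory.eq_of_homotopy _ _ h)

instance {ι : Type w} [HasProductsOfShape ι A] :
    HasProductsOfShape ι (HomotopyCategory A (ComplexShape.up ℤ)) :=
  ⟨fun F =>
    have : HasProduct (F.obj ∘ Discrete.mk) := ⟨⟨_, quotientPiIsLimit fun i => (F.obj ⟨i⟩).as⟩⟩
    hasLimit_of_iso Discrete.natIsoFunctor.symm⟩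

instance {ι : Type w} [HasCoproductsOfShape ι A] :
    HasCoproductsOfShape ι (HomotopyCategory A (ComplexShape.up ℤ)) :=
  ⟨fun F =>
    have : HasCoproduct (F.obj ∘ Discrete.mk) :=
      ⟨⟨_, quotientSigmaIsColimit fun i => (F.obj ⟨i⟩).as⟩⟩
    hasColimit_of_iso Discrete.natIsoFunctor⟩

lemma isoClosure_termwise_pi {ι : Type w} [HasProductsOfShape ι A] (Q : ObjectProperty A)
    (hQ : ∀ X : ι → A, (∀ i, Q (X i)) → Q (∏ᶜ X)) [Q.IsClosedUnderIsomorphisms]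
    (X : ι → HomotopyCategory A (ComplexShape.up ℤ)) (hX : ∀ i, (termwise Q).isoClosure (X i)) :
    (termwise Q).isoClosure (∏ᶜ X) := by
  choose Y hY e using hX
  refine ⟨_, fun n => ?_, ⟨(Pi.mapIso fun i => (e i).some) ≪≫
    (limit.isLimit _).conePointUniqueUpToIso (quotientPiIsLimit fun i => (Y i).as)⟩⟩
  exact Q.prop_of_iso (PreservesProduct.iso (HomologicalComplex.eval A (ComplexShape.up ℤ) n)
    fun i => (Y i).as).symm (hQ _ fun i => hY i n)

lemma isoClosure_termwise_sigma {ι : Type w} [HasCoproductsOfShape ι A] (Q : ObjectProperty A)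
    (hQ : ∀ X : ι → A, (∀ i, Q (X i)) → Q (∐ X)) [Q.IsClosedUnderIsomorphisms]
    (X : ι → HomotopyCategory A (ComplexShape.up ℤ)) (hX : ∀ i, (termwise Q).isoClosure (X i)) :
    (termwise Q).isoClosure (∐ X) := by
  choose Y hY e using hX
  refine ⟨_, fun n => ?_, ⟨(Sigma.mapIso fun i => (e i).some) ≪≫
    (colimit.isColimit _).coconePointUniqueUpToIso (quotientSigmaIsColimit fun i => (Y i).as)⟩⟩
  exact Q.prop_of_iso (PreservesCoproduct.iso (HomologicalComplex.eval A (ComplexShape.up ℤ) n)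
    fun i => (Y i).as).symm (hQ _ fun i => hY i n)

end Homotopy

/-! ### Homotopical resolutions of unbounded complexes. -/

section Resolutions

variable {A : Type u} [Category.{v} A] [Abelian A]

/-! ### Complexes with zero differential -/

/-- As `J` has zero differential, `f` factors in degree `n` through the opcycles of `M`. It vanishes
on homology there, so by injectivity it extends along the map from the opcycles to `M.X (n + 1)`;
this extension is the homotopy. -/
lemma nonempty_homotopy_zero_of_injective {M J : CochainComplex A ℤ}
    (hJ : ∀ n : ℤ, Injective (J.X n)) (hd : ∀ i j : ℤ, J.d i j = 0) (f : M ⟶ J)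
    (hf : ∀ n : ℤ, HomologicalComplex.homologyMap f n = 0) : Nonempty (Homotopy f 0) := by
  have key : ∀ n : ℤ, ∃ h : M.X (n + 1) ⟶ J.X n, M.d n (n + 1) ≫ h = f.f n := fun n => by
    let g : M.opcycles n ⟶ J.X n := M.descOpcycles (f.f n) (n - 1) (by simp) (by
      rw [← f.comm, hd, comp_zero])
    have hg : M.homologyι n ≫ g = 0 := by
      have h : g = HomologicalComplex.opcyclesMap f n ≫
          J.descOpcycles (𝟙 (J.X n)) (n - 1) (by simp) (by rw [hd, zero_comp]) := by
        rw [← cancel_epi (M.pOpcycles n)]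
        simp [g]
      rw [h, ← Category.assoc, ← HomologicalComplex.homologyι_naturality, hf, zero_comp, zero_comp]
    have hex := ShortComplex.exact_of_f_is_kernel
      (ShortComplex.mk (M.homologyι n) (M.fromOpcycles n (n + 1)) (by simp))
      (M.homologyIsKernel n (n + 1) (by simp))
    have := hJ n
    obtain ⟨h, hh⟩ : ∃ h : M.X (n + 1) ⟶ J.X n, M.fromOpcycles n (n + 1) ≫ h = g :=
      ⟨hex.descToInjective g hg, hex.comp_descToInjective g hg⟩
    exact ⟨h, by rw [← M.p_fromOpcycles n (n + 1), Category.assoc, hh]; simp [g]⟩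
  choose h hh using key
  let H : ∀ i j : ℤ, (ComplexShape.up ℤ).Rel j i → (M.X i ⟶ J.X j) := fun i j hij =>
    (M.XIsoOfEq (hij : j + 1 = i).symm).hom ≫ h j
  have e : f = Homotopy.nullHomotopicMap' H := by
    ext n
    rw [Homotopy.nullHomotopicMap'_f (k₂ := n - 1) (k₁ := n) (k₀ := n + 1) (by simp) (by simp),
      hd, comp_zero, add_zero, ← hh]
    simp [H]
  rw [e]
  exact ⟨Homotopy.nullHomotopy' H⟩

lemma nonempty_homotopy_zero_of_projective {P M : CochainComplex A ℤ}
    (hP : ∀ n : ℤ, Projective (P.X n)) (hd : ∀ i j : ℤ, P.d i j = 0) (f : P ⟶ M)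
    (hf : ∀ n : ℤ, HomologicalComplex.homologyMap f n = 0) : Nonempty (Homotopy f 0) := by
  have key : ∀ n : ℤ, ∃ h : P.X n ⟶ M.X (n - 1), h ≫ M.d (n - 1) n = f.f n := fun n => by
    let g : P.X n ⟶ M.cycles n := M.liftCycles (f.f n) (n + 1) (by simp) (by
      rw [f.comm, hd, zero_comp])
    have hg : g ≫ M.homologyπ n = 0 := by
      have h : g = P.liftCycles (𝟙 (P.X n)) (n + 1) (by simp) (by rw [hd, comp_zero]) ≫
          HomologicalComplex.cyclesMap f n := by
        rw [← cancel_mono (M.iCycles n)]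
        simp [g]
      rw [h, Category.assoc, ← HomologicalComplex.homologyπ_naturality, hf, ← Category.assoc,
        comp_zero]
    have hex := ShortComplex.exact_of_g_is_cokernel
      (ShortComplex.mk (M.toCycles (n - 1) n) (M.homologyπ n) (by simp))
      (M.homologyIsCokernel (n - 1) n (by simp))
    have := hP n
    obtain ⟨h, hh⟩ : ∃ h : P.X n ⟶ M.X (n - 1), h ≫ M.toCycles (n - 1) n = g :=
      ⟨hex.liftFromProjective g hg, hex.liftFromProjective_comp g hg⟩
    exact ⟨h, by rw [← M.toCycles_i (n - 1) n, ← Category.assoc, hh]; simp [g]⟩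
  choose h hh using key
  let H : ∀ i j : ℤ, (ComplexShape.up ℤ).Rel j i → (P.X i ⟶ M.X j) := fun i j hij =>
    h i ≫ (M.XIsoOfEq (show i - 1 = j by have : j + 1 = i := hij; omega)).hom
  have e : f = Homotopy.nullHomotopicMap' H := by
    ext n
    rw [Homotopy.nullHomotopicMap'_f (k₂ := n - 1) (k₁ := n) (k₀ := n + 1) (by simp) (by simp),
      hd, zero_comp, zero_add, ← hh]
    simp [H]
  rw [e]
  exact ⟨Homotopy.nullHomotopy' H⟩

lemma exists_homologyMap_mono [CategoryTheory.EnoughInjectives A] (M : CochainComplex A ℤ) :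
    ∃ (J : CochainComplex A ℤ) (q : M ⟶ J), (∀ n : ℤ, Injective (J.X n)) ∧
      (∀ i j : ℤ, J.d i j = 0) ∧ ∀ n : ℤ, Mono (HomologicalComplex.homologyMap q n) := by
  let J : CochainComplex A ℤ :=
    -- Opcycles are a quotient of `M.X n` containing the homology, so embedding them yields both a
    -- chain map and a monomorphism on homology.
    { X := fun n => Injective.under (M.opcycles n)
      d := fun _ _ => 0 }
  let q : M ⟶ J :=
    { f := fun n => M.pOpcycles n ≫ Injective.ι (M.opcycles n)
      comm' := fun i j _ => by simp [J] }
  refine ⟨J, q, fun n => inferInstanceAs (Injective (Injective.under _)), fun _ _ => rfl,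
    fun n => ?_⟩
  have h : HomologicalComplex.homologyMap q n ≫ J.homologyι n ≫
      J.descOpcycles (𝟙 (J.X n)) (n - 1) (by simp) zero_comp =
      M.homologyι n ≫ Injective.ι (M.opcycles n) := by
    rw [HomologicalComplex.homologyι_naturality_assoc]
    congr 1
    rw [← cancel_epi (M.pOpcycles n)]
    simp [q]
  exact mono_of_mono_fac h

lemma exists_homologyMap_epi [CategoryTheory.EnoughProjectives A] (M : CochainComplex A ℤ) :
    ∃ (P : CochainComplex A ℤ) (p : P ⟶ M), (∀ n : ℤ, Projective (P.X n)) ∧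
      (∀ i j : ℤ, P.d i j = 0) ∧ ∀ n : ℤ, Epi (HomologicalComplex.homologyMap p n) := by
  let P : CochainComplex A ℤ :=
    { X := fun n => Projective.over (M.cycles n)
      d := fun _ _ => 0 }
  let p : P ⟶ M :=
    { f := fun n => Projective.π (M.cycles n) ≫ M.iCycles n
      comm' := fun i j _ => by simp [P] }
  refine ⟨P, p, fun n => inferInstanceAs (Projective (Projective.over _)), fun _ _ => rfl,
    fun n => ?_⟩
  have h : (P.liftCycles (𝟙 (P.X n)) (n + 1) (by simp) comp_zero ≫ P.homologyπ n) ≫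
      HomologicalComplex.homologyMap p n = Projective.π (M.cycles n) ≫ M.homologyπ n := by
    rw [Category.assoc, HomologicalComplex.homologyπ_naturality, ← Category.assoc]
    congr 1
    rw [← cancel_mono (M.iCycles n)]
    simp [p]
  exact epi_of_epi_fac h

/-! ### Consequences in the homotopy category -/

variable (A) in
/-- The complexes of injective objects with zero differential. -/
abbrev injectiveZero : ObjectProperty (HomotopyCategory A (ComplexShape.up ℤ)) :=
  termwiseZero (isInjective (C := A))

variable (A) in
/-- The complexes of projective objects with zero differential. -/
abbrev projectiveZero : ObjectProperty (HomotopyCategory A (ComplexShape.up ℤ)) :=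
  termwiseZero (isProjective A)

lemma homologyMap_eq_zero_of_quotient_map_eq_zero {K L : CochainComplex A ℤ} (f : K ⟶ L)
    (hf : (HomotopyCategory.quotient A (ComplexShape.up ℤ)).map f = 0) (n : ℤ) :
    HomologicalComplex.homologyMap f n = 0 := by
  have h := (HomotopyCategory.homotopyOfEq f 0 (hf.trans (Functor.map_zero _ _ _).symm))
  rw [h.homologyMap_eq n, HomologicalComplex.homologyMap_zero]

/-- Maps out of `P` are detected on homology, where `q` is injective. -/
lemma eq_zero_of_projectiveZero_of_comp {P : HomotopyCategory A (ComplexShape.up ℤ)}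
    (hP : projectiveZero A P) {M J : CochainComplex A ℤ}
    (k : P ⟶ (HomotopyCategory.quotient A (ComplexShape.up ℤ)).obj M) (q : M ⟶ J)
    (hq : ∀ n : ℤ, Mono (HomologicalComplex.homologyMap q n))
    (hk : k ≫ (HomotopyCategory.quotient A (ComplexShape.up ℤ)).map q = 0) : k = 0 := by
  obtain ⟨P, rfl⟩ := P.quotient_obj_surjective
  obtain ⟨k, rfl⟩ := (HomotopyCategory.quotient A (ComplexShape.up ℤ)).map_surjective k
  have hX : ∀ n : ℤ, Projective (P.X n) := hP.1
  have hd : ∀ i j : ℤ, P.d i j = 0 := hP.2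
  obtain ⟨h⟩ := nonempty_homotopy_zero_of_projective hX hd k fun n => by
    have := hq n
    rw [← cancel_mono (HomologicalComplex.homologyMap q n), zero_comp,
      ← HomologicalComplex.homologyMap_comp]
    exact homologyMap_eq_zero_of_quotient_map_eq_zero _ ((Functor.map_comp _ _ _).trans hk) n
  rw [HomotopyCategory.eq_of_homotopy _ _ h, Functor.map_zero]

lemma eq_zero_of_injectiveZero_of_comp {J : HomotopyCategory A (ComplexShape.up ℤ)}
    (hJ : injectiveZero A J) {P M : CochainComplex A ℤ} (p : P ⟶ M)
    (k : (HomotopyCategory.quotient A (ComplexShape.up ℤ)).obj M ⟶ J)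
    (hp : ∀ n : ℤ, Epi (HomologicalComplex.homologyMap p n))
    (hk : (HomotopyCategory.quotient A (ComplexShape.up ℤ)).map p ≫ k = 0) : k = 0 := by
  obtain ⟨J, rfl⟩ := J.quotient_obj_surjective
  obtain ⟨k, rfl⟩ := (HomotopyCategory.quotient A (ComplexShape.up ℤ)).map_surjective k
  have hX : ∀ n : ℤ, Injective (J.X n) := hJ.1
  have hd : ∀ i j : ℤ, J.d i j = 0 := hJ.2
  obtain ⟨h⟩ := nonempty_homotopy_zero_of_injective hX hd k fun n => by
    have := hp n
    rw [← cancel_epi (HomologicalComplex.homologyMap p n), comp_zero,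
      ← HomologicalComplex.homologyMap_comp]
    exact homologyMap_eq_zero_of_quotient_map_eq_zero _ ((Functor.map_comp _ _ _).trans hk) n
  rw [HomotopyCategory.eq_of_homotopy _ _ h, Functor.map_zero]

lemma rightOrthogonal_of_injectiveZero {J : HomotopyCategory A (ComplexShape.up ℤ)}
    (hJ : injectiveZero A J) : (HomotopyCategory.subcategoryAcyclic A).rightOrthogonal J := by
  intro N k hN
  obtain ⟨N, rfl⟩ := N.quotient_obj_surjective
  rw [HomotopyCategory.quotient_obj_mem_subcategoryAcyclic_iff_exactAt] at hN
  -- On an acyclic complex even the zero endomorphism is epi on homology.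
  exact eq_zero_of_injectiveZero_of_comp hJ (0 : N ⟶ N) k
    (fun n => ((N.exactAt_iff_isZero_homology n).1 (hN n)).epi _)
    (by rw [Functor.map_zero, zero_comp])

lemma leftOrthogonal_of_projectiveZero {P : HomotopyCategory A (ComplexShape.up ℤ)}
    (hP : projectiveZero A P) : (HomotopyCategory.subcategoryAcyclic A).leftOrthogonal P := by
  intro N k hN
  obtain ⟨N, rfl⟩ := N.quotient_obj_surjective
  rw [HomotopyCategory.quotient_obj_mem_subcategoryAcyclic_iff_exactAt] at hN
  exact eq_zero_of_projectiveZero_of_comp hP k (0 : N ⟶ N)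
    (fun n => ((N.exactAt_iff_isZero_homology n).1 (hN n)).mono _)
    (by rw [Functor.map_zero, comp_zero])

/-- The map from `exists_homologyMap_epi` is surjective on homology; if it vanishes in the homotopy
category, the homology is zero. -/
lemma subcategoryAcyclic_of_projectiveZero [CategoryTheory.EnoughProjectives A]
    {N : HomotopyCategory A (ComplexShape.up ℤ)}
    (hN : ∀ P, projectiveZero A P → ∀ k : P ⟶ N, k = 0) :
    HomotopyCategory.subcategoryAcyclic A N := by
  obtain ⟨N, rfl⟩ := N.quotient_obj_surjective
  rw [HomotopyCategory.quotient_obj_mem_subcategoryAcyclic_iff_exactAt]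
  intro n
  obtain ⟨P, p, hP, hd, hp⟩ := exists_homologyMap_epi N
  have := hp n
  rw [N.exactAt_iff_isZero_homology]
  exact IsZero.of_epi_eq_zero _ (homologyMap_eq_zero_of_quotient_map_eq_zero p
    (hN ((HomotopyCategory.quotient A (ComplexShape.up ℤ)).obj P) ⟨hP, hd⟩ _) n)

lemma subcategoryAcyclic_of_injectiveZero [CategoryTheory.EnoughInjectives A]
    {N : HomotopyCategory A (ComplexShape.up ℤ)}
    (hN : ∀ J, injectiveZero A J → ∀ k : N ⟶ J, k = 0) :
    HomotopyCategory.subcategoryAcyclic A N := by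
  obtain ⟨N, rfl⟩ := N.quotient_obj_surjective
  rw [HomotopyCategory.quotient_obj_mem_subcategoryAcyclic_iff_exactAt]
  intro n
  obtain ⟨J, q, hJ, hd, hq⟩ := exists_homologyMap_mono N
  have := hq n
  rw [N.exactAt_iff_isZero_homology]
  exact IsZero.of_mono_eq_zero _ (homologyMap_eq_zero_of_quotient_map_eq_zero q
    (hN ((HomotopyCategory.quotient A (ComplexShape.up ℤ)).obj J) ⟨hJ, hd⟩ _) n)

/-! ### Resolutions of unbounded complexes -/

variable (A) in
/-- The objects isomorphic to K-injective complexes of injective objects. -/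
abbrev dgInj : ObjectProperty (HomotopyCategory A (ComplexShape.up ℤ)) :=
  (termwise (isInjective (C := A))).isoClosure ⊓
    (HomotopyCategory.subcategoryAcyclic A).rightOrthogonal

variable (A) in
/-- The objects isomorphic to K-projective complexes of projective objects. -/
abbrev dgProj : ObjectProperty (HomotopyCategory A (ComplexShape.up ℤ)) :=
  (termwise (isProjective A)).isoClosure ⊓
    (HomotopyCategory.subcategoryAcyclic A).leftOrthogonal

instance : (isInjective (C := A)).IsClosedUnderIsomorphisms :=
  ⟨fun e h => Injective.of_iso e h⟩

instance : (isProjective A).IsClosedUnderIsomorphisms :=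
  ⟨fun e h => Projective.of_iso e h⟩

instance : (termwise (isInjective (C := A))).IsTriangulated :=
  isTriangulated_termwise _ (fun _ h => h.injective)
    fun X Y (_ : Injective X) (_ : Injective Y) => inferInstanceAs (Injective (X ⊞ Y))

instance : (termwise (isProjective A)).IsTriangulated :=
  isTriangulated_termwise _ (fun _ h => h.projective)
    fun X Y (_ : Projective X) (_ : Projective Y) => inferInstanceAs (Projective (X ⊞ Y))

lemma dgInj_pi [HasProductsOfShape ℕ A] (X : ℕ → HomotopyCategory A (ComplexShape.up ℤ))
    (hX : ∀ n, dgInj A (X n)) : dgInj A (∏ᶜ X) :=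
  ⟨isoClosure_termwise_pi (isInjective (C := A)) (fun Y (hY : ∀ i, Injective (Y i)) =>
      ⟨fun g f _ => ⟨Pi.lift fun i => Injective.factorThru (g ≫ Pi.π Y i) f,
        Pi.hom_ext _ _ fun i => by simp⟩⟩) X fun n => (hX n).1,
    fun _ k hN => Pi.hom_ext _ _ fun n => ((hX n).2 (k ≫ Pi.π X n) hN).trans zero_comp.symm⟩

lemma dgProj_sigma [HasCoproductsOfShape ℕ A] (X : ℕ → HomotopyCategory A (ComplexShape.up ℤ))
    (hX : ∀ n, dgProj A (X n)) : dgProj A (∐ X) :=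
  ⟨isoClosure_termwise_sigma (isProjective A) (fun Y (hY : ∀ i, Projective (Y i)) =>
      ⟨fun f e _ => ⟨Sigma.desc fun i => Projective.factorThru (Sigma.ι Y i ≫ f) e,
        Sigma.hom_ext _ _ fun i => by simp⟩⟩) X fun n => (hX n).1,
    fun _ k hN => Sigma.hom_ext _ _ fun n => ((hX n).2 (Sigma.ι X n ≫ k) hN).trans comp_zero.symm⟩

theorem exists_dgInj_triangle [CategoryTheory.EnoughInjectives A]
    [CategoryTheory.EnoughProjectives A] [HasProductsOfShape ℕ A]
    (X : HomotopyCategory A (ComplexShape.up ℤ)) :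
    ∃ (N I : HomotopyCategory A (ComplexShape.up ℤ)) (f : N ⟶ X) (g : X ⟶ I) (h : I ⟶ N⟦(1 : ℤ)⟧),
      HomotopyCategory.subcategoryAcyclic A N ∧ dgInj A I ∧ Triangle.mk f g h ∈ distTriang _ := by
  obtain ⟨N, f, ⟨I, g, h, hT, hI⟩, hN⟩ := exists_trW_of_phantom (projectiveZero A) (dgInj A)
    dgInj_pi (fun M => by
      obtain ⟨M, rfl⟩ := M.quotient_obj_surjective
      obtain ⟨J, q, hJ, hd, hq⟩ := exists_homologyMap_mono M
      obtain ⟨F, i, h, hT⟩ := distinguished_cocone_triangle₁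
        ((HomotopyCategory.quotient A (ComplexShape.up ℤ)).map q)
      have hiq : i ≫ (HomotopyCategory.quotient A (ComplexShape.up ℤ)).map q = 0 :=
        comp_distTriang_mor_zero₁₂ _ hT
      refine ⟨F, i, ⟨_, _, _, hT, ObjectProperty.le_isoClosure _ _ hJ,
        rightOrthogonal_of_injectiveZero ⟨hJ, hd⟩⟩, fun P hP k => ?_⟩
      -- The fibre inclusion is phantom: `k ≫ i` is killed by `q`.
      exact eq_zero_of_projectiveZero_of_comp hP _ q hq (by
        rw [Category.assoc, hiq, comp_zero])) X
  exact ⟨N, I, f, g, h, subcategoryAcyclic_of_projectiveZero hN, hI, hT⟩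

theorem exists_dgProj_triangle [CategoryTheory.EnoughInjectives A]
    [CategoryTheory.EnoughProjectives A] [HasCoproductsOfShape ℕ A]
    (X : HomotopyCategory A (ComplexShape.up ℤ)) :
    ∃ (P N : HomotopyCategory A (ComplexShape.up ℤ)) (f : P ⟶ X) (g : X ⟶ N) (h : N ⟶ P⟦(1 : ℤ)⟧),
      dgProj A P ∧ HomotopyCategory.subcategoryAcyclic A N ∧ Triangle.mk f g h ∈ distTriang _ := by
  obtain ⟨N, g, hg, hN⟩ := exists_trW_of_cophantom (injectiveZero A) (dgProj A)
    dgProj_sigma (fun M => by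
      obtain ⟨M, rfl⟩ := M.quotient_obj_surjective
      obtain ⟨P, p, hP, hd, hp⟩ := exists_homologyMap_epi M
      obtain ⟨F, i, h, hT⟩ := distinguished_cocone_triangle
        ((HomotopyCategory.quotient A (ComplexShape.up ℤ)).map p)
      have hpi : (HomotopyCategory.quotient A (ComplexShape.up ℤ)).map p ≫ i = 0 :=
        comp_distTriang_mor_zero₁₂ _ hT
      refine ⟨F, i, (ObjectProperty.trW_iff' _ _).2 ⟨_, _, _, hT,
        ObjectProperty.le_isoClosure _ _ hP,
        leftOrthogonal_of_projectiveZero ⟨hP, hd⟩⟩, fun J hJ k => ?_⟩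
      exact eq_zero_of_injectiveZero_of_comp hJ p _ hp (by
        rw [← Category.assoc, hpi, zero_comp])) X
  obtain ⟨P, f, h, hT, hP⟩ := (ObjectProperty.trW_iff' _ _).1 hg
  exact ⟨P, N, f, g, h, hP, subcategoryAcyclic_of_injectiveZero hN, hT⟩

end Resolutions

/-! ### Identification of the orthogonals, and degenerate cases. -/

section General

variable {A : Type u} [Category.{v} A] [Abelian A]

lemma isZero_of_isZero_dgProj [CategoryTheory.EnoughProjectives A]
    (h : ∀ P, dgProj A P → IsZero P) (M : A) : IsZero M := by
  have hM := subcategoryAcyclic_of_projectiveZero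
    (N := (HomotopyCategory.quotient A (ComplexShape.up ℤ)).obj
      ((HomologicalComplex.single A (ComplexShape.up ℤ) 0).obj M))
    (fun P hP k => (h P ⟨ObjectProperty.le_isoClosure _ _ hP.1,
      leftOrthogonal_of_projectiveZero hP⟩).eq_of_src _ _)
  rw [HomotopyCategory.quotient_obj_mem_subcategoryAcyclic_iff_exactAt] at hM
  exact ((HomologicalComplex.exactAt_iff_isZero_homology _ _).1 (hM 0)).of_iso
    (HomologicalComplex.singleObjHomologySelfIso (ComplexShape.up ℤ) 0 M).symm

lemma projective_of_isoClosure_termwise (M : A)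
    (h : (termwise (isProjective A)).isoClosure
      ((HomotopyCategory.quotient A (ComplexShape.up ℤ)).obj
        ((HomologicalComplex.single A (ComplexShape.up ℤ) 0).obj M))) : Projective M := by
  obtain ⟨Y, hY, ⟨e⟩⟩ := h
  obtain ⟨K, rfl⟩ := Y.quotient_obj_surjective
  obtain ⟨i, hi⟩ := (HomotopyCategory.quotient A (ComplexShape.up ℤ)).map_surjective e.hom
  obtain ⟨r, hr⟩ := (HomotopyCategory.quotient A (ComplexShape.up ℤ)).map_surjective e.inv
  have H : Homotopy (i ≫ r) (𝟙 _) := HomotopyCategory.homotopyOfEq _ _ (by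
    rw [Functor.map_comp, hi, hr, e.hom_inv_id, CategoryTheory.Functor.map_id])
  have hK : Projective (K.X 0) := hY 0
  -- The single complex has zero differentials, so the homotopy terms disappear and `M` is a genuine
  -- retract of `K.X 0`.
  have hir : i.f 0 ≫ r.f 0 = 𝟙 _ := by
    have h := H.comm 0
    rw [dNext_eq _ (show (ComplexShape.up ℤ).Rel 0 1 by simp),
      prevD_eq _ (show (ComplexShape.up ℤ).Rel (-1) 0 by simp),
      HomologicalComplex.single_obj_d, HomologicalComplex.single_obj_d, zero_comp, comp_zero,
      zero_add, zero_add] at h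
    exact h
  have : Projective (((HomologicalComplex.single A (ComplexShape.up ℤ) 0).obj M).X 0) :=
    Projective.mk fun f e _ => ⟨i.f 0 ≫ Projective.factorThru (r.f 0 ≫ f) e, by
      rw [Category.assoc, Projective.factorThru_comp, reassoc_of% hir]⟩
  exact Projective.of_iso (HomologicalComplex.singleObjXSelf (ComplexShape.up ℤ) 0 M) this

variable [CategoryTheory.EnoughInjectives A] [CategoryTheory.EnoughProjectives A]

/-- In the resolution triangle of such an `X`, the acyclic term also lies in the right orthogonal.
Its identity is then zero, so `X` is isomorphic to its resolution. -/
lemma rightOrthogonal_eq_dgInj [HasProductsOfShape ℕ A] :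
    (HomotopyCategory.subcategoryAcyclic A).rightOrthogonal = dgInj A := by
  refine le_antisymm (fun X hX => ?_) inf_le_right
  obtain ⟨N, I, f, g, h, hN, hI, hT⟩ := exists_dgInj_triangle X
  have hN' : (HomotopyCategory.subcategoryAcyclic A).rightOrthogonal N :=
    ObjectProperty.ext_of_isTriangulatedClosed₁ _ _ hT hX hI.2
  have hN0 : IsZero N := (IsZero.iff_id_eq_zero N).2 (hN' (𝟙 N) hN)
  have : IsIso g := (Triangle.isZero₁_iff_isIso₂ _ hT).1 hN0
  exact (dgInj A).prop_of_iso (asIso g).symm hI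

lemma leftOrthogonal_eq_dgProj [HasCoproductsOfShape ℕ A] :
    (HomotopyCategory.subcategoryAcyclic A).leftOrthogonal = dgProj A := by
  refine le_antisymm (fun X hX => ?_) inf_le_right
  obtain ⟨P, N, f, g, h, hP, hN, hT⟩ := exists_dgProj_triangle X
  have hN' : (HomotopyCategory.subcategoryAcyclic A).leftOrthogonal N :=
    ObjectProperty.ext_of_isTriangulatedClosed₃ _ _ hT hP.2 hX
  have hN0 : IsZero N := (IsZero.iff_id_eq_zero N).2 (hN' (𝟙 N) hN)
  have : IsIso f := (Triangle.isZero₃_iff_isIso₁ _ hT).1 hN0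
  exact (dgProj A).prop_of_iso (asIso f) hP

lemma isBalancedPair_dgProj_dgInj [HasProductsOfShape ℕ A] [HasCoproductsOfShape ℕ A] :
    IsBalancedPair (dgProj A) (dgInj A) := by
  rw [← leftOrthogonal_eq_dgProj, ← rightOrthogonal_eq_dgInj]
  refine isBalancedPair_of_orthogonal (fun X => ?_) (fun X => ?_)
  · obtain ⟨P, N, f, g, h, hP, hN, hT⟩ := exists_dgProj_triangle X
    exact ⟨P, N, f, g, h, hP.2, hN, hT⟩
  · obtain ⟨N, I, f, g, h, hN, hI, hT⟩ := exists_dgInj_triangle X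
    exact ⟨N, I, f, g, h, hN, hI.2, hT⟩

lemma projective_of_isZero_acyclic [HasCoproductsOfShape ℕ A]
    (h : ∀ N, HomotopyCategory.subcategoryAcyclic A N → IsZero N) (M : A) : Projective M := by
  refine projective_of_isoClosure_termwise M ?_
  have hM : (HomotopyCategory.subcategoryAcyclic A).leftOrthogonal
      ((HomotopyCategory.quotient A (ComplexShape.up ℤ)).obj
        ((HomologicalComplex.single A (ComplexShape.up ℤ) 0).obj M)) :=
    -- If acyclic complexes vanish, every object is left orthogonal to them, hence isomorphic to a
    -- complex of projectives.
    fun N k hN => (h N hN).eq_of_tgt _ _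
  rw [leftOrthogonal_eq_dgProj] at hM
  exact hM.1

end General

/-! ### Translation to modules and semisimplicity. -/

section Modules

variable (R : Type u) [Ring R]

lemma acyclic_iff_tildeClass_top (L : CochainComplex (ModuleCat.{u} R) ℤ) :
    tildeClass ⊤ L ↔ L.Acyclic :=
  ⟨fun h => h.1, fun h => ⟨h, fun _ => trivial⟩⟩

lemma dgProjective_eq : dgProjective R = dgProj (ModuleCat.{u} R) := by
  ext X
  constructor
  · rintro ⟨K, ⟨hK, hK'⟩, ⟨e⟩⟩
    refine (dgProj (ModuleCat.{u} R)).prop_of_iso e.symm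
      ⟨ObjectProperty.le_isoClosure _ _ hK, ?_⟩
    rw [← CochainComplex.isKProjective_iff_leftOrthogonal]
    exact ⟨fun f hL => hK' _ f ((acyclic_iff_tildeClass_top R _).2 hL)⟩
  · rintro ⟨⟨Y, hY, ⟨e⟩⟩, hX⟩
    have hK : CochainComplex.IsKProjective Y.as := by
      rw [CochainComplex.isKProjective_iff_leftOrthogonal]
      exact ObjectProperty.prop_of_iso _ e hX
    exact ⟨Y.as, ⟨hY, fun L f hL =>
      hK.nonempty_homotopy_zero f ((acyclic_iff_tildeClass_top R _).1 hL)⟩, ⟨e⟩⟩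

lemma dgInjective_eq : dgInjective R = dgInj (ModuleCat.{u} R) := by
  ext X
  constructor
  · rintro ⟨K, ⟨hK, hK'⟩, ⟨e⟩⟩
    refine (dgInj (ModuleCat.{u} R)).prop_of_iso e.symm
      ⟨ObjectProperty.le_isoClosure _ _ hK, ?_⟩
    rw [← CochainComplex.isKInjective_iff_rightOrthogonal]
    exact ⟨fun f hL => hK' _ f ((acyclic_iff_tildeClass_top R _).2 hL)⟩
  · rintro ⟨⟨Y, hY, ⟨e⟩⟩, hX⟩
    have hK : CochainComplex.IsKInjective Y.as := by
      rw [CochainComplex.isKInjective_iff_rightOrthogonal]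
      exact ObjectProperty.prop_of_iso _ e hX
    exact ⟨Y.as, ⟨hY, fun L f hL =>
      hK.nonempty_homotopy_zero f ((acyclic_iff_tildeClass_top R _).1 hL)⟩, ⟨e⟩⟩

lemma isSemisimpleRing_of_projective (h : ∀ M : ModuleCat.{u} R, Projective M) :
    IsSemisimpleRing R := by
  refine { exists_isCompl := fun I => ?_ }
  have : Module.Projective R (R ⧸ I) := (IsProjective.iff_projective _).2 (h (.of R (R ⧸ I)))
  obtain ⟨s, hs⟩ := Module.projective_lifting_property I.mkQ LinearMap.id I.mkQ_surjective
  have hs' : ∀ x, I.mkQ (s x) = x := fun x => congr($hs x)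
  exact ⟨_, LinearMap.isCompl_of_proj
    -- A section `s` of `R ⟶ R ⧸ I` gives the projection `x ↦ x - s(x̄)` onto `I`, whose kernel is
    -- the complement.
    (f := LinearMap.codRestrict I (LinearMap.id - s ∘ₗ I.mkQ) fun x => by
      rw [← Submodule.Quotient.mk_eq_zero]
      change I.mkQ (x - s (I.mkQ x)) = 0
      rw [map_sub, hs', sub_self])
    (fun x => by
      ext
      have hx : I.mkQ (x : R) = 0 := (Submodule.Quotient.mk_eq_zero I).2 x.2
      change (x : R) - s (I.mkQ x) = x
      rw [hx, map_zero, sub_zero])⟩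

lemma isSemisimpleRing_of_isZero (h : ∀ M : ModuleCat.{u} R, IsZero M) : IsSemisimpleRing R :=
  isSemisimpleRing_of_projective R fun M => (h M).projective

end Modules

end ExtriCat

end

/-! ### The main theorem. -/

theorem mainTheorem5 (R : Type u) [Ring R] :
    ExtriCat.IsBalancedPair (ExtriCat.dgProjective R) (ExtriCat.dgInjective R) ∧
    ∃ hξ : ExtriCat.IsProperClass (ExtriCat.lowerClass (ExtriCat.dgProjective R)),
      hξ.extData.IsExtriangulated ∧
      (¬ IsSemisimpleRing R → ¬ hξ.extData.IsExact ∧ ¬ hξ.extData.IsTriangulated) := by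
  have hbal : ExtriCat.IsBalancedPair (ExtriCat.dgProjective R) (ExtriCat.dgInjective R) := by
    rw [ExtriCat.dgProjective_eq, ExtriCat.dgInjective_eq]
    exact ExtriCat.isBalancedPair_dgProj_dgInj
  have hξ := ExtriCat.isProperClass_lowerClass hbal.left
  refine ⟨hbal, hξ, ExtriCat.isExtriangulated_lowerClass hbal.left hξ,
    fun hR => ⟨fun h => hR ?_, fun h => hR ?_⟩⟩
  · refine ExtriCat.isSemisimpleRing_of_projective R
      (ExtriCat.projective_of_isZero_acyclic fun N hN => ?_)
    -- Extensions are maps into a suspension, so the identity of `N` is replaced by this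
    -- isomorphism, which is phantom because `N` is acyclic.
    let e : N ≅ (N⟦(-1 : ℤ)⟧)⟦(1 : ℤ)⟧ := (shiftNegShift N (1 : ℤ)).symm
    have he : e.hom = 0 := ExtriCat.phantom_eq_zero_of_isExact hbal.left hξ h e.hom
      fun P hP k => by
        rw [ExtriCat.dgProjective_eq] at hP
        rw [hP.2 k hN, zero_comp]
    rw [IsZero.iff_id_eq_zero, ← e.hom_inv_id, he, zero_comp]
  · refine ExtriCat.isSemisimpleRing_of_isZero R
      (ExtriCat.isZero_of_isZero_dgProj fun P hP => ?_)
    rw [← ExtriCat.dgProjective_eq] at hP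
    exact ExtriCat.isZero_of_isTriangulated hbal.left hξ h P hP
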